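/- Let $n\ge 1$ and let $\Gamma=\{(\alpha_1,\dots,\alpha_n)\in\mathbb{R}^n: 0\le\alpha_n\le\alpha_{n-1}\le\cdots\le\alpha_1\le 1\}$, with vertices $v_0=(0,\dots,0)$ and $v_i=(1,\dots,1,0,\dots,0)$ ($n+1-i$ entries equal to $1$) for $1\le i\le n$. Let $\lambda$ be Lebesgue measure on $\Gamma$, normalized so that $\lambda(\Gamma)=1$. Let $\tau_0,\tau_1:\Gamma\to\Gamma$ be the affine maps with $\tau_0v_0=v_0$, $\tau_1v_0=v_1$ and, for $a=0,1$, $\tau_av_i=v_{i+1}$ for $1\le i<n$ and $\tau_av_n=\frac12(v_0+v_1)$. Explicitly, with the convention $\beta_{n+1}=0$, the $i$-th coordinate of $\tau_0(\beta_1,\dots,\beta_n)$ is $\beta_{i+1}+\frac{\beta_1-\beta_2}{2}$ and that of $\tau_1(\beta_1,\dots,\beta_n)$ is $\beta_{i+1}+\frac{2-\beta_1-\beta_2}{2}$. Let $\Gamma^o$ be the set of points of $\Gamma$ whose barycentric coordinate at $v_0$ is positive, that is, $\Gamma^o=\{\alpha\in\Gamma:\alpha_1<1\}$, and let $v_{-1}$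 be the unique fixed point of $\tau_1$ in $\Gamma$. The sets $\{v_{-1}\}$, $\tau_0\Gamma^o$, $\tau_1\tau_0\Gamma^o$, $\tau_1^2\tau_0\Gamma^o,\dots$ form a partition of $\Gamma$, and $\tau_0,\tau_1$ are injective, so one can define $K:\Gamma\to\Gamma$ by $Kv_{-1}=v_0$ and $K=\tau_0^k\tau_1(\tau_1^k\tau_0)^{-1}$ on $\tau_1^k\tau_0\Gamma^o$, for every $k\ge0$. Then $K$ is a bijection of $\Gamma$, and for every $p\in\Gamma$ the sequence $p,Kp,K^2p,\dots$ is $\lambda$-uniformly distributed: for every continuous $f:\Gamma\to\mathbb{R}$, $$\lim_{k\to\infty}\frac1k\sum_{i=0}^{k-1}f(K^ip)=\int_\Gamma f\,d\lambda .$$ Consequently $(\Gamma,K)$ is uniquely ergodic with invariant measure $\lambda$: the map $K$ is Borel measurable and preserves $\lambda$, and $\lambda$ is the only $K$-invariant Borel probability measure on $\Gamma$. -/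

import Mathlib

open MeasureTheory Filter Topology
open scoped Matrix

namespace KakutaniSimplex

/-! ## The simplex and the two affine maps -/

/-- The `n`-simplex `Γ = {(α₁,…,αₙ) : 0 ≤ αₙ ≤ ⋯ ≤ α₁ ≤ 1}` in `ℝⁿ`. -/
def Gamma (n : ℕ) : Set (Fin n → ℝ) :=
  {p | (∀ i, 0 ≤ p i ∧ p i ≤ 1) ∧ Antitone p}

/-- The matrix whose columns are the vertices `v₀,…,vₙ` of `Γ` in projective coordinates: with
rows and columns numbered from `1`, the entry `ij` is `1` if `i = n+1`, or if `j ≥ 2` and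
`i + j ≤ n + 2`, and is `0` otherwise. -/
noncomputable def V (n : ℕ) : Matrix (Fin (n + 1)) (Fin (n + 1)) ℝ :=
  Matrix.of fun i j =>
    if (i : ℕ) = n ∨ (1 ≤ (j : ℕ) ∧ (i : ℕ) + (j : ℕ) ≤ n) then 1 else 0

/-- The column-stochastic matrices `B₀` and `B₁`.  With columns numbered from `0` to `n`: column `0`
is the unit vector `e_a`, column `j` is `e_{j+1}` for `1 ≤ j < n`, and column `n` is
`(e₀ + e₁) / 2`. -/
noncomputable def B (n : ℕ) (a : Fin 2) : Matrix (Fin (n + 1)) (Fin (n + 1)) ℝ :=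
  Matrix.of fun i j =>
    if (j : ℕ) = n then (if (i : ℕ) = 0 ∨ (i : ℕ) = 1 then 1 / 2 else 0)
    else if (j : ℕ) = 0 then (if (i : ℕ) = (a : ℕ) then 1 else 0)
    else (if (i : ℕ) = (j : ℕ) + 1 then 1 else 0)

/-- `D_a = V B_a V⁻¹`. -/
noncomputable def D (n : ℕ) (a : Fin 2) : Matrix (Fin (n + 1)) (Fin (n + 1)) ℝ :=
  V n * B n a * (V n)⁻¹

/-- Projective coordinates `(α₁,…,αₙ,1)` of a point. -/
def hom {n : ℕ} (p : Fin n → ℝ) : Fin (n + 1) → ℝ := Fin.snoc (α := fun _ => ℝ) p 1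

/-- The affine map of `ℝⁿ` determined by `D_a`. -/
noncomputable def tauFun (n : ℕ) (a : Fin 2) (p : Fin n → ℝ) : Fin n → ℝ :=
  fun i => (D n a *ᵥ hom p) i.castSucc

/-- The `k`-th coordinate (numbered from `0`), with the convention that it is `0` for `k ≥ n`. -/
def coord {n : ℕ} (p : Fin n → ℝ) (k : ℕ) : ℝ := if h : k < n then p ⟨k, h⟩ else 0

/-- Candidate for `V⁻¹ y`. -/
def bary {n : ℕ} (y : Fin (n + 1) → ℝ) (j : Fin (n + 1)) : ℝ :=
  if (j : ℕ) = 0 then y (Fin.last n) - coord (fun i : Fin n => y i.castSucc) 0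
  else coord (fun i : Fin n => y i.castSucc) (n - j) -
    coord (fun i : Fin n => y i.castSucc) (n - j + 1)

theorem V_mulVec_bary {n : ℕ} (y : Fin (n + 1) → ℝ) : V n *ᵥ bary y = y := by
  set c : ℕ → ℝ := coord (fun i : Fin n => y i.castSucc) with hc
  have hcn : c n = 0 := by simp [hc, coord]
  have key : ∀ m, m ≤ n →
      ∑ j ∈ Finset.range m, (c (n - (j + 1)) - c (n - (j + 1) + 1)) = c (n - m) := by
    intro m hm
    have h1 : ∀ j ∈ Finset.range m, c (n - (j + 1)) - c (n - (j + 1) + 1) =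
        c (n - (j + 1)) - c (n - j) := by
      intro j hj
      have := Finset.mem_range.mp hj
      rw [show n - (j + 1) + 1 = n - j by omega]
    rw [Finset.sum_congr rfl h1, Finset.sum_range_sub (fun j => c (n - j))]
    simp [hcn]
  have hb : ∀ j : Fin n, bary y j.succ = c (n - (j + 1)) - c (n - (j + 1) + 1) := by
    intro j; simp [bary, hc]
  funext i
  rw [Matrix.mulVec, dotProduct, Fin.sum_univ_succ]
  simp only [hb]
  by_cases hi : (i : ℕ) = n
  · have hi' : i = Fin.last n := Fin.ext hi
    have : ∀ j, V n i j = 1 := fun j => by simp [V, hi]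
    simp only [this, one_mul]
    rw [Fin.sum_univ_eq_sum_range (fun j => c (n - (j + 1)) - c (n - (j + 1) + 1)) n,
      key n le_rfl]
    simp [bary, hc, hi']
  · have hlt : (i : ℕ) < n := by have := i.2; omega
    have h0 : V n i 0 = 0 := by simp [V, hi]
    have hs : ∀ j : Fin n, V n i j.succ * (c (n - (j + 1)) - c (n - (j + 1) + 1)) =
        (fun k : ℕ => if k < n - i then (c (n - (k + 1)) - c (n - (k + 1) + 1)) else 0) j := by
      intro j
      have : ((i : ℕ) + (j + 1) ≤ n) ↔ (j : ℕ) < n - i := by omega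
      simp [V, hi, this]
    simp only [hs, h0, zero_mul, zero_add]
    rw [Fin.sum_univ_eq_sum_range
      (fun k : ℕ => if k < n - i then (c (n - (k + 1)) - c (n - (k + 1) + 1)) else 0) n,
      ← Finset.sum_filter]
    have hf : (Finset.range n).filter (fun k => k < n - (i : ℕ)) = Finset.range (n - i) := by
      ext k; simp; omega
    rw [hf, key _ (by omega), show n - (n - (i : ℕ)) = i by omega]
    simp [hc, coord, hlt]

theorem isUnit_V (n : ℕ) : IsUnit (V n) :=
  Matrix.mulVec_surjective_iff_isUnit.mp fun y => ⟨bary y, V_mulVec_bary y⟩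

/-- The explicit form of the affine maps: `τ₀` sends `β` to the point with `i`-th coordinate
`β_{i+1} + (β₁ - β₂) / 2`, and `τ₁` to the point with `i`-th coordinate
`β_{i+1} + (2 - β₁ - β₂) / 2`, where `β_{n+1} = 0`. -/
noncomputable def tauFormula (n : ℕ) (a : Fin 2) (p : Fin n → ℝ) : Fin n → ℝ := fun i =>
  coord p (i + 1) +
    (if a = 0 then coord p 0 - coord p 1 else 2 - coord p 0 - coord p 1) / 2

theorem B_mulVec_bary {n : ℕ} (hn : 1 ≤ n) (a : Fin 2) (p : Fin n → ℝ) :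
    B n a *ᵥ bary (hom p) = bary (hom (tauFormula n a p)) := by
  obtain ⟨m, rfl⟩ : ∃ m, n = m + 1 := ⟨n - 1, by omega⟩
  have hh : ∀ q : Fin (m + 1) → ℝ, (fun i : Fin (m + 1) => hom q i.castSucc) = q := by
    intro q; funext i; simp [hom]
  have hl : ∀ q : Fin (m + 1) → ℝ, hom q (Fin.last (m + 1)) = 1 := by
    intro q; simp [hom]
  have hc : ∀ k, coord (tauFormula (m + 1) a p) k = if k < m + 1 then coord p (k + 1) +
      (if a = 0 then coord p 0 - coord p 1 else 2 - coord p 0 - coord p 1) / 2 else 0 := by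
    intro k
    by_cases hk : k < m + 1
    · rw [if_pos hk]
      simp only [coord.eq_1 (tauFormula (m + 1) a p), dif_pos hk, tauFormula]
    · rw [if_neg hk, coord, dif_neg hk]
  have hz : ∀ k, m + 1 ≤ k → coord p k = 0 := by
    intro k hk; simp [coord, Nat.not_lt.mpr hk]
  funext i
  rw [Matrix.mulVec, dotProduct, Fin.sum_univ_succ, Fin.sum_univ_castSucc]
  have hmid : ∀ j : Fin m, B (m + 1) a i j.castSucc.succ * bary (hom p) j.castSucc.succ =
      if (i : ℕ) = j + 2 then coord p (m + 2 - i) - coord p (m + 2 - i + 1) else 0 := by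
    intro j
    have hj : (j : ℕ) ≠ m := j.2.ne
    by_cases h : (i : ℕ) = j + 2
    · have e1 : m + 2 - (j + 2 : ℕ) = m - j := by omega
      have e2 : m + 1 - (j + 1 : ℕ) = m - j := by omega
      simp [B, bary, hh, h, hj, e1, e2]
    · simp [B, bary, hj, h]
  have hsum : ∑ j : Fin m, (if (i : ℕ) = j + 2 then
      coord p (m + 2 - i) - coord p (m + 2 - i + 1) else 0) =
      if 2 ≤ (i : ℕ) then coord p (m + 2 - i) - coord p (m + 2 - i + 1) else 0 := by
    by_cases h : 2 ≤ (i : ℕ)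
    · have hi := i.2
      rw [Finset.sum_eq_single (⟨(i : ℕ) - 2, by omega⟩ : Fin m)]
      · simp [h]
      · intro b _ hb
        rw [if_neg]
        intro h'
        exact hb (Fin.ext (by simp; omega))
      · simp
    · rw [if_neg h]
      refine Finset.sum_eq_zero fun j _ => if_neg (by omega)
  simp only [hmid, hsum]
  have hi := i.2
  have hB0 : B (m + 1) a i 0 = if (i : ℕ) = (a : ℕ) then 1 else 0 := by simp [B]
  have hBl : B (m + 1) a i (Fin.last m).succ =
      if (i : ℕ) = 0 ∨ (i : ℕ) = 1 then 1 / 2 else 0 := by simp [B]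
  have hx0 : bary (hom p) 0 = 1 - coord p 0 := by simp [bary, hh, hl]
  have hxl : bary (hom p) (Fin.last m).succ = coord p 0 - coord p 1 := by simp [bary, hh]
  rw [hB0, hBl, hx0, hxl]
  simp only [bary, hh, hl, hc]
  have ha : a = 0 ∨ a = 1 := by fin_cases a <;> simp
  rcases Nat.lt_or_ge (i : ℕ) 2 with h2 | h2
  · rcases (by omega : (i : ℕ) = 0 ∨ (i : ℕ) = 1) with h | h
    · rcases ha with rfl | rfl <;> simp [h] <;> ring
    · have hz1 := hz (m + 1) le_rfl
      rcases ha with rfl | rfl <;> simp [h, hz1] <;> ring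
  · have h0 : (i : ℕ) ≠ 0 := by omega
    have h1 : (i : ℕ) ≠ 1 := by omega
    have e1 : m + 1 - (i : ℕ) + 1 = m + 2 - i := by omega
    have e2 : m + 1 - (i : ℕ) < m + 1 := by omega
    have e3 : m + 2 - (i : ℕ) < m + 1 := by omega
    rcases ha with rfl | rfl <;> simp [h0, h1, h2, e1, e2, e3]

theorem D_mulVec_hom {n : ℕ} (hn : 1 ≤ n) (a : Fin 2) (p : Fin n → ℝ) :
    D n a *ᵥ hom p = hom (tauFormula n a p) := by
  have hV : (V n)⁻¹ *ᵥ hom p = bary (hom p) := by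
    conv_lhs => rw [← V_mulVec_bary (hom p)]
    rw [Matrix.mulVec_mulVec, Matrix.nonsing_inv_mul _ ((Matrix.isUnit_iff_isUnit_det _).mp
      (isUnit_V n)), Matrix.one_mulVec]
  rw [D, ← Matrix.mulVec_mulVec, hV, ← Matrix.mulVec_mulVec, B_mulVec_bary hn, V_mulVec_bary]

theorem tauFun_eq {n : ℕ} (a : Fin 2) (p : Fin n → ℝ) : tauFun n a p = tauFormula n a p := by
  rcases Nat.eq_zero_or_pos n with rfl | hn
  · exact Subsingleton.elim _ _
  · funext i
    rw [tauFun, D_mulVec_hom hn, hom, Fin.snoc_castSucc]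

theorem coord_of_mem {n : ℕ} {p : Fin n → ℝ} (hp : p ∈ Gamma n) :
    (∀ k, 0 ≤ coord p k ∧ coord p k ≤ 1) ∧ Antitone (coord p) := by
  have h0 : ∀ k, 0 ≤ coord p k ∧ coord p k ≤ 1 := by
    intro k
    unfold coord
    split_ifs with h
    · exact hp.1 _
    · norm_num
  refine ⟨h0, fun k l hkl => ?_⟩
  by_cases hl : l < n
  · have hk : k < n := lt_of_le_of_lt hkl hl
    simp only [coord, hk, hl, dif_pos]
    exact hp.2 hkl
  · have : coord p l = 0 := by simp [coord, hl]
    rw [this]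
    exact (h0 k).1

theorem tauFun_mem {n : ℕ} (a : Fin 2) {p : Fin n → ℝ} (hp : p ∈ Gamma n) :
    tauFun n a p ∈ Gamma n := by
  obtain ⟨h1, h2⟩ := coord_of_mem hp
  rw [tauFun_eq]
  refine ⟨fun i => ?_, fun i j hij => ?_⟩
  · have h01 := h2 (Nat.zero_le 1)
    have h1i : coord p (i + 1) ≤ coord p 1 := h2 (by omega)
    have := h1 0
    have := h1 (i + 1)
    unfold tauFormula
    split_ifs <;> constructor <;> linarith
  · unfold tauFormula
    have : coord p (j + 1) ≤ coord p (i + 1) := h2 (by simpa using hij)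
    linarith

/-- The map `τ_a : Γ → Γ`. -/
noncomputable def tau (n : ℕ) (a : Fin 2) (p : Gamma n) : Gamma n :=
  ⟨tauFun n a p, tauFun_mem a p.2⟩

/-! ## The Kakutani-von Neumann map -/

/-- The vertex `v₀ = (0,…,0)`. -/
def vZero (n : ℕ) : Gamma n := ⟨0, by simp [Gamma, Antitone]⟩

/-- The set `Γ°` of all points of `Γ` with positive barycentric coordinate `x₀` relative to the
vertices `v₀,…,vₙ`, the columns of `V`. -/
def GammaO (n : ℕ) : Set (Gamma n) :=
  {p | ∃ x : Fin (n + 1) → ℝ, (∀ j, 0 ≤ x j) ∧ ∑ j, x j = 1 ∧ 0 < x 0 ∧ hom p.1 = V n *ᵥ x}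

/-- The point `v₋₁`, with `i`-th coordinate `2 (n + 1 - i) / (2 n + 1)` for `1 ≤ i ≤ n`; it is the
fixed point of `τ₁`, see `tau_one_vNegOne`. -/
noncomputable def vNegOne (n : ℕ) : Gamma n :=
  ⟨fun i => 2 * ((n : ℝ) - (i : ℕ)) / (2 * n + 1), by
    refine ⟨fun i => ?_, fun i j hij => ?_⟩
    · have h : ((i : ℕ) : ℝ) ≤ n := by exact_mod_cast i.2.le
      refine ⟨div_nonneg (by linarith) (by positivity), ?_⟩
      rw [div_le_one (by positivity)]
      have : (0 : ℝ) ≤ (i : ℕ) := by positivity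
      linarith
    · have h : ((i : ℕ) : ℝ) ≤ (j : ℕ) := by exact_mod_cast hij
      exact div_le_div_of_nonneg_right (by linarith) (by positivity)⟩

open Classical in
/-- The Kakutani-von Neumann map `K : Γ → Γ`: on `τ₁ᵏ τ₀ Γ°` it is `τ₀ᵏ τ₁ (τ₁ᵏ τ₀)⁻¹`, and the only
point of `Γ` that belongs to none of these sets, the fixed point `v₋₁` of `τ₁`, is sent to `v₀`.
The sets `τ₁ᵏ τ₀ Γ°` are pairwise disjoint and the maps are injective, so that the choices are
immaterial; see `K_tau` and `K_vNegOne`. -/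
noncomputable def K (n : ℕ) (p : Gamma n) : Gamma n :=
  if h : ∃ (k : ℕ) (q : Gamma n), q ∈ GammaO n ∧ (tau n 1)^[k] (tau n 0 q) = p then
    (tau n 0)^[h.choose] (tau n 1 h.choose_spec.choose)
  else vZero n

theorem GammaO_coord_lt {n : ℕ} {p : Gamma n} (hp : p ∈ GammaO n) : coord p.1 0 < 1 := by
  obtain ⟨x, hx, hs, h0, hV⟩ := hp
  by_cases hn : 0 < n
  · have h1 := congrFun hV (⟨0, hn⟩ : Fin n).castSucc
    rw [Matrix.mulVec, dotProduct, Fin.sum_univ_succ] at h1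
    rw [Fin.sum_univ_succ] at hs
    have e1 : coord p.1 0 = hom p.1 (⟨0, hn⟩ : Fin n).castSucc := by
      simp only [hom, Fin.snoc_castSucc]
      simp [coord, hn]
    have e2 : ∀ j : Fin n, V n (⟨0, hn⟩ : Fin n).castSucc j.succ = 1 := by
      intro j
      have := j.2
      have : (j : ℕ) + 1 ≤ n := by omega
      simp [V, this]
    have e3 : V n (⟨0, hn⟩ : Fin n).castSucc 0 = 0 := by
      simp [V, hn.ne]
    simp only [e2, e3, zero_mul, one_mul, zero_add] at h1
    rw [e1, h1]
    linarith
  · simp [coord, hn]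

theorem tau_val {n : ℕ} (a : Fin 2) (p : Gamma n) : (tau n a p).1 = tauFormula n a p.1 :=
  tauFun_eq a p.1

theorem tau_injective {n : ℕ} (hn : 1 ≤ n) (a : Fin 2) : Function.Injective (tau n a) := by
  intro p q h
  have h' : tauFormula n a p.1 = tauFormula n a q.1 := by rw [← tau_val, ← tau_val, h]
  have hk : ∀ k, k < n → tauFormula n a p.1 = tauFormula n a q.1 →
      coord p.1 (k + 1) + (if a = 0 then coord p.1 0 - coord p.1 1
        else 2 - coord p.1 0 - coord p.1 1) / 2 =
      coord q.1 (k + 1) + (if a = 0 then coord q.1 0 - coord q.1 1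
        else 2 - coord q.1 0 - coord q.1 1) / 2 := fun k hk h => congrFun h ⟨k, hk⟩
  have hz : ∀ p : Gamma n, coord p.1 n = 0 := fun p => by simp [coord]
  have hlast := hk (n - 1) (by omega) h'
  rw [show n - 1 + 1 = n by omega, hz, hz, zero_add, zero_add] at hlast
  have hs : ∀ k, k < n → coord p.1 (k + 1) = coord q.1 (k + 1) := by
    intro k hkn
    have := hk k hkn h'
    linarith
  have h1 := hs 0 (by omega)
  rw [zero_add] at h1
  have h0 : coord p.1 0 = coord q.1 0 := by
    split_ifs at hlast <;> linarith
  have hall : ∀ k, k < n → coord p.1 k = coord q.1 k := by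
    intro k hkn
    rcases k with _ | k
    · exact h0
    · exact hs k (by omega)
  apply Subtype.ext
  funext i
  have := hall i i.2
  simpa [coord] using this

theorem tau_zero_ne_tau_one {n : ℕ} (hn : 1 ≤ n) {p : Gamma n} (hp : p ∈ GammaO n)
    (q : Gamma n) : tau n 0 p ≠ tau n 1 q := by
  intro h
  have h' : tauFormula n 0 p.1 = tauFormula n 1 q.1 := by rw [← tau_val, ← tau_val, h]
  have hf := congrFun h' ⟨0, hn⟩
  have hl := congrFun h' ⟨n - 1, by omega⟩
  have hz : ∀ p : Gamma n, coord p.1 (n - 1 + 1) = 0 := fun p => by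
    simp [coord, show ¬ (n - 1 + 1 < n) by omega]
  simp only [tauFormula, hz, zero_add] at hf hl
  norm_num at hf hl
  have h1 := GammaO_coord_lt hp
  have h2 := ((coord_of_mem q.2).1 0).2
  linarith

/-- The defining property of `K` on `τ₁ᵏ τ₀ Γ°`. -/
theorem K_tau {n : ℕ} (hn : 1 ≤ n) (k : ℕ) {q : Gamma n} (hq : q ∈ GammaO n) :
    K n ((tau n 1)^[k] (tau n 0 q)) = (tau n 0)^[k] (tau n 1 q) := by
  have uniq : ∀ (k l : ℕ) (q r : Gamma n), q ∈ GammaO n → r ∈ GammaO n →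
      (tau n 1)^[k] (tau n 0 q) = (tau n 1)^[l] (tau n 0 r) → k = l ∧ q = r := by
    intro k
    induction k with
    | zero =>
      intro l q r hq hr h
      rcases l with _ | l
      · exact ⟨rfl, tau_injective hn 0 h⟩
      · rw [Function.iterate_succ_apply'] at h
        exact absurd h (tau_zero_ne_tau_one hn hq _)
    | succ k ih =>
      intro l q r hq hr h
      rcases l with _ | l
      · rw [Function.iterate_succ_apply'] at h
        exact absurd h.symm (tau_zero_ne_tau_one hn hr _)
      · rw [Function.iterate_succ_apply', Function.iterate_succ_apply'] at h
        obtain ⟨h1, h2⟩ := ih l q r hq hr (tau_injective hn 1 h)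
        exact ⟨by rw [h1], h2⟩
  have h : ∃ (l : ℕ) (r : Gamma n), r ∈ GammaO n ∧
      (tau n 1)^[l] (tau n 0 r) = (tau n 1)^[k] (tau n 0 q) := ⟨k, q, hq, rfl⟩
  rw [K, dif_pos h]
  obtain ⟨h1, h2⟩ := uniq _ _ _ _ h.choose_spec.choose_spec.1 hq h.choose_spec.choose_spec.2
  exact congrArg₂ (fun l r => (tau n 0)^[l] (tau n 1 r)) h1 h2

theorem tau_one_vNegOne {n : ℕ} (hn : 1 ≤ n) : tau n 1 (vNegOne n) = vNegOne n := by
  have hc : ∀ k, k ≤ n → coord (vNegOne n).1 k = 2 * ((n : ℝ) - k) / (2 * n + 1) := by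
    intro k hk
    by_cases h : k < n
    · simp [coord, h, vNegOne]
    · have : k = n := by omega
      simp [coord, this]
  apply Subtype.ext
  rw [tau_val]
  funext i
  have h1 : (2 * (n : ℝ) + 1) ≠ 0 := by positivity
  rw [tauFormula, hc _ i.2, hc 0 (by omega), hc 1 hn]
  simp only [vNegOne]
  push_cast
  norm_num
  field_simp
  ring

/-- `K v₋₁ = v₀`. -/
theorem K_vNegOne {n : ℕ} (hn : 1 ≤ n) : K n (vNegOne n) = vZero n := by
  rw [K, dif_neg]
  rintro ⟨k, q, hq, h⟩
  have hv := tau_one_vNegOne hn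
  have hk : (tau n 1)^[k] (vNegOne n) = vNegOne n := Function.iterate_fixed hv k
  rw [← hk] at h
  have h' := (tau_injective hn 1).iterate k h
  rw [← hv] at h'
  exact tau_zero_ne_tau_one hn hq _ h'

/-! ## Uniform distribution and unique ergodicity -/

/-- Lebesgue measure on `Γ`, normalized to total mass `1`. -/
noncomputable def lam (n : ℕ) : Measure (Gamma n) :=
  (volume (Gamma n))⁻¹ • Measure.comap Subtype.val (volume : Measure (Fin n → ℝ))

/-- The sequence `x₀, x₁, …` in `X` is `ν`-uniformly distributed. -/
def UniformlyDistributed {X : Type*} [TopologicalSpace X] [MeasurableSpace X] (ν : Measure X)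
    (x : ℕ → X) : Prop :=
  ∀ f : C(X, ℝ), Tendsto (fun k : ℕ => (1 / (k : ℝ)) * ∑ i ∈ Finset.range k, f (x i)) atTop
    (𝓝 (∫ y, f y ∂ν))

/-- `S` is uniquely ergodic, and `ν` is its invariant probability measure. -/
def UniquelyErgodicWith {X : Type*} [MeasurableSpace X] (S : X → X) (ν : Measure X) : Prop :=
  ∀ m : Measure X, (IsProbabilityMeasure m ∧ MeasurePreserving S m m) ↔ m = ν

end KakutaniSimplex

/-! The map `K` is an adding machine with carry: `K (τ₀ q) = τ₁ q` for `q ∈ Γ°`, and `K (τ₁ q) = τ₀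
(K q)` for all `q` (`K_tau_zero`, `K_tau_one`). The halves `τ₀ Γ` and `τ₁ Γ` meet only in the image
of the face `α₁ = 1`, where `τ₀ = τ₁`. Bijectivity says that peeling off digits fails only at `v₋₁`
in the domain and only at `v₀` in the range (`eq_vNegOne_or`, `eq_vZero_or`).

Two facts about `τ₀`, `τ₁` drive the rest. In barycentric coordinates they are column-stochastic,
hence nonexpansive in `ℓ¹`, and a power of `B₁` is positive, so a power of `τ₁` contracts. Both also
scale volume by the same factor, so `2λ = τ₀∗λ + τ₁∗λ`. Hence the averages of `f` over the `2ᵗ`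
words of length `t` tend uniformly to `∫ f dλ` (`avg_uniform_limit`).

The `K`-orbit of `τ₀ q` returns to `τ₀ Γ` at `τ₀ (K q)`, after two steps if `q ∈ Γ°` and after one
otherwise. Iterating, Birkhoff sums of `f` along an orbit starting in `τ₀ᵗ Γ` are Birkhoff sums of
`towerᵗ f` (`birkhoffSum_tau_zero_iterate`). Over interior points `towerᵗ f` is `2ᵗ` times the word
average. Over boundary points some words are missing, but in long towers almost every word leads to
the interior (`exists_tower_compl_le`). So if `∫ f = 0`, every long block has a small average
(`exists_abs_tower_le`), and every orbit is equidistributed. Invariance of `λ` comes from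
self-similarity, and uniqueness from integrating the Birkhoff averages. -/

namespace KakutaniSimplex

/-! ### Barycentric coordinates -/

/-- The barycentric coordinates of a point of `Γ`. -/
noncomputable def baryc {n : ℕ} (p : Gamma n) : Fin (n + 1) → ℝ := bary (hom p.1)

theorem V_mulVec_baryc {n : ℕ} (p : Gamma n) : V n *ᵥ baryc p = hom p.1 := V_mulVec_bary _

theorem baryc_tau {n : ℕ} (hn : 1 ≤ n) (a : Fin 2) (p : Gamma n) :
    baryc (tau n a p) = B n a *ᵥ baryc p := by
  rw [baryc, baryc, tau_val, B_mulVec_bary hn]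

theorem baryc_zero {n : ℕ} (p : Gamma n) : baryc p 0 = 1 - coord p.1 0 := by
  simp [baryc, bary, hom]

theorem baryc_nonneg {n : ℕ} (p : Gamma n) (j : Fin (n + 1)) : 0 ≤ baryc p j := by
  obtain ⟨h1, h2⟩ := coord_of_mem p.2
  by_cases hj : (j : ℕ) = 0
  · rw [show j = 0 from Fin.ext hj, baryc_zero]
    linarith [(h1 0).2]
  · have := h2 (Nat.le_succ (n - j))
    simpa [baryc, bary, hom, hj] using this

theorem baryc_sum {n : ℕ} (p : Gamma n) : ∑ j, baryc p j = 1 := by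
  have h := congrFun (V_mulVec_baryc p) (Fin.last n)
  simpa [Matrix.mulVec, dotProduct, V, hom] using h

theorem mem_GammaO_iff {n : ℕ} {p : Gamma n} : p ∈ GammaO n ↔ coord p.1 0 < 1 := by
  refine ⟨GammaO_coord_lt, fun h => ⟨baryc p, baryc_nonneg p, baryc_sum p, ?_,
    (V_mulVec_baryc p).symm⟩⟩
  rw [baryc_zero]
  linarith

theorem coord_zero_of_notMem {n : ℕ} {p : Gamma n} (hp : p ∉ GammaO n) : coord p.1 0 = 1 :=
  le_antisymm ((coord_of_mem p.2).1 0).2 (not_lt.mp fun h => hp (mem_GammaO_iff.mpr h))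

/-- The `ℓ¹` distance between barycentric coordinates. -/
noncomputable def baryDist {n : ℕ} (p q : Gamma n) : ℝ := ∑ j, |baryc p j - baryc q j|

theorem baryDist_nonneg {n : ℕ} (p q : Gamma n) : 0 ≤ baryDist p q :=
  Finset.sum_nonneg fun _ _ => abs_nonneg _

theorem baryDist_le_two {n : ℕ} (p q : Gamma n) : baryDist p q ≤ 2 := by
  have : baryDist p q ≤ ∑ j, (baryc p j + baryc q j) := Finset.sum_le_sum fun j _ => by
    rw [abs_le]
    constructor <;> linarith [baryc_nonneg p j, baryc_nonneg q j]
  rw [Finset.sum_add_distrib, baryc_sum, baryc_sum] at this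
  linarith

theorem dist_le_baryDist {n : ℕ} (p q : Gamma n) : dist p q ≤ baryDist p q := by
  rw [Subtype.dist_eq, dist_pi_le_iff (baryDist_nonneg p q)]
  intro i
  have h : ∀ r : Gamma n, r.1 i = ∑ j, V n i.castSucc j * baryc r j := by
    intro r
    have := congrFun (V_mulVec_baryc r) i.castSucc
    simpa [Matrix.mulVec, dotProduct, hom] using this.symm
  rw [Real.dist_eq, h p, h q, ← Finset.sum_sub_distrib]
  refine (Finset.abs_sum_le_sum_abs _ _).trans (Finset.sum_le_sum fun j _ => ?_)
  rw [← mul_sub, abs_mul]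
  refine mul_le_of_le_one_left (abs_nonneg _) ?_
  simp only [V, Matrix.of_apply]
  split_ifs <;> simp

/-! ### Column-stochastic matrices and contraction -/

/-- Subtracting `ε` from every entry does not change `M *ᵥ u`, since the entries of `u` sum to `0`.
What remains is nonnegative with column sums `1 - m ε`. -/
theorem l1_mulVec_le {m : ℕ} (M : Matrix (Fin m) (Fin m) ℝ) (ε : ℝ) (hM : ∀ i j, ε ≤ M i j)
    (hs : ∀ j, ∑ i, M i j = 1) (u : Fin m → ℝ) (hu : ∑ j, u j = 0) :
    ∑ i, |(M *ᵥ u) i| ≤ (1 - m * ε) * ∑ j, |u j| := by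
  have h1 : ∀ i, |(M *ᵥ u) i| ≤ ∑ j, (M i j - ε) * |u j| := by
    intro i
    have : (M *ᵥ u) i = ∑ j, (M i j - ε) * u j := by
      simp only [sub_mul, Finset.sum_sub_distrib, ← Finset.mul_sum, hu]
      simp [Matrix.mulVec, dotProduct]
    rw [this]
    refine (Finset.abs_sum_le_sum_abs _ _).trans (Finset.sum_le_sum fun j _ => ?_)
    rw [abs_mul, abs_of_nonneg (sub_nonneg.mpr (hM i j))]
  refine (Finset.sum_le_sum fun i _ => h1 i).trans_eq ?_
  rw [Finset.sum_comm, Finset.mul_sum]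
  refine Finset.sum_congr rfl fun j _ => ?_
  rw [← Finset.sum_mul, Finset.sum_sub_distrib, hs]
  simp

theorem B_nonneg {n : ℕ} (a : Fin 2) (i j : Fin (n + 1)) : 0 ≤ B n a i j := by
  simp only [B, Matrix.of_apply]
  split_ifs <;> norm_num

theorem B_col_sum {n : ℕ} (hn : 1 ≤ n) (a : Fin 2) (j : Fin (n + 1)) : ∑ i, B n a i j = 1 := by
  obtain ⟨m, rfl⟩ : ∃ m, n = m + 1 := ⟨n - 1, by omega⟩
  have hj := j.2
  simp only [B, Matrix.of_apply]
  by_cases h : (j : ℕ) = m + 1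
  · simp only [if_pos h]
    rw [Fin.sum_univ_succ, Fin.sum_univ_succ]
    simp
    norm_num
  · simp only [if_neg h]
    by_cases h0 : (j : ℕ) = 0
    · simp only [if_pos h0]
      have ha := a.2
      rw [Finset.sum_eq_single (⟨a, by omega⟩ : Fin (m + 2))]
      · simp
      · intro b _ hb
        rw [if_neg fun h => hb (Fin.ext h)]
      · simp
    · simp only [if_neg h0]
      rw [Finset.sum_eq_single (⟨j + 1, by omega⟩ : Fin (m + 2))]
      · simp
      · intro b _ hb
        rw [if_neg fun h => hb (Fin.ext h)]
      · simp

theorem pow_col_sum {m : ℕ} {M : Matrix (Fin m) (Fin m) ℝ} (hs : ∀ j, ∑ i, M i j = 1) (k : ℕ)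
    (j : Fin m) : ∑ i, (M ^ k) i j = 1 := by
  induction k generalizing j with
  | zero => simp [Matrix.one_apply]
  | succ k ih =>
    simp only [pow_succ, Matrix.mul_apply]
    rw [Finset.sum_comm]
    simp only [← Finset.sum_mul, ih, one_mul, hs]

theorem pow_nonneg_entry {m : ℕ} {M : Matrix (Fin m) (Fin m) ℝ} (hM : ∀ i j, 0 ≤ M i j) (k : ℕ)
    (i j : Fin m) : 0 ≤ (M ^ k) i j := by
  induction k generalizing i with
  | zero => rw [pow_zero, Matrix.one_apply]; split_ifs <;> norm_num
  | succ k ih =>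
    rw [pow_succ', Matrix.mul_apply]
    exact Finset.sum_nonneg fun l _ => mul_nonneg (hM _ _) (ih _)

theorem pow_succ_pos {m : ℕ} {M : Matrix (Fin m) (Fin m) ℝ} (hM : ∀ i j, 0 ≤ M i j) {k : ℕ}
    {i l j : Fin m} (h1 : 0 < M i l) (h2 : 0 < (M ^ k) l j) : 0 < (M ^ (k + 1)) i j := by
  rw [pow_succ', Matrix.mul_apply]
  exact Finset.sum_pos' (fun l _ => mul_nonneg (hM _ _) (pow_nonneg_entry hM k _ _))
    ⟨l, Finset.mem_univ _, mul_pos h1 h2⟩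

/-- A positive entry `i j` is an arrow `j → i`. The arrows `0 → 1 → ⋯ → n`, `n → 0` and `n → 1` give
cycles through `n` of the coprime lengths `n + 1` and `n`, so every long enough time admits a path
from `j` to `n` and on to `i`. -/
theorem B_one_pow_pos {n : ℕ} (hn : 1 ≤ n) (i j : Fin (n + 1)) :
    0 < (B n 1 ^ ((n + 1) ^ 2)) i j := by
  have hB := B_nonneg (n := n) 1
  have up : ∀ (d i k : ℕ) (hi : i + d < n + 1), 0 < (B n 1 ^ k) ⟨i, by omega⟩ j →
      0 < (B n 1 ^ (k + d)) ⟨i + d, hi⟩ j := by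
    intro d
    induction d with
    | zero => intro i k hi h; exact h
    | succ d ih =>
      intro i k hi h
      refine pow_succ_pos hB (l := ⟨i + d, by omega⟩) ?_ (ih i k (by omega) h)
      have h1 : i + d ≠ n := by omega
      by_cases h0 : i + d = 0
      · simp [B, h0, show ¬ (0 = n) by omega, show i + (d + 1) = 1 by omega]
      · have h2 : ¬ (i = 0 ∧ d = 0) := by omega
        simp [B, h1, h2, add_assoc]
  have wrap : ∀ k, 0 < (B n 1 ^ k) (Fin.last n) j →
      0 < (B n 1 ^ (k + 1)) 0 j ∧ 0 < (B n 1 ^ (k + 1)) ⟨1, by omega⟩ j := by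
    intro k h
    exact ⟨pow_succ_pos hB (by simp [B]) h, pow_succ_pos hB (by simp [B]) h⟩
  have y1 : ∀ k, 0 < (B n 1 ^ k) (Fin.last n) j → 0 < (B n 1 ^ (k + n)) (Fin.last n) j := by
    intro k h
    have := up (n - 1) 1 (k + 1) (by omega) (wrap k h).2
    rw [show k + 1 + (n - 1) = k + n by omega] at this
    convert this using 2
    exact Fin.ext (by simp; omega)
  have y2 : ∀ k, 0 < (B n 1 ^ k) (Fin.last n) j → 0 < (B n 1 ^ (k + (n + 1))) (Fin.last n) j := by
    intro k h
    have := up n 0 (k + 1) (by omega) (wrap k h).1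
    rw [show k + 1 + n = k + (n + 1) by omega] at this
    convert this using 2
    exact Fin.ext (by simp)
  have y1' : ∀ a k, 0 < (B n 1 ^ k) (Fin.last n) j → 0 < (B n 1 ^ (k + a * n)) (Fin.last n) j := by
    intro a
    induction a with
    | zero => intro k h; simpa using h
    | succ a ih => intro k h; have := y1 _ (ih k h); rwa [add_assoc, ← Nat.succ_mul] at this
  have y2' : ∀ b k, 0 < (B n 1 ^ k) (Fin.last n) j →
      0 < (B n 1 ^ (k + b * (n + 1))) (Fin.last n) j := by
    intro a
    induction a with
    | zero => intro k h; simpa using h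
    | succ a ih => intro k h; have := y2 _ (ih k h); rwa [add_assoc, ← Nat.succ_mul] at this
  have hj := j.2
  have hi := i.2
  have start : 0 < (B n 1 ^ (n - j)) (Fin.last n) j := by
    have := up (n - j) j 0 (by omega) (by simp)
    convert this using 2
    · omega
    · exact Fin.ext (by simp; omega)
  have late : ∀ m, n + n * n ≤ m → 0 < (B n 1 ^ m) (Fin.last n) j := by
    intro m hm
    set e := m - (n - j) with he
    -- With quotient `e / n ≥ n > e % n`, the time `e` splits into `e % n` cycles of length `n + 1`
    -- and `e / n - e % n` cycles of length `n`.
    have h1 : n ≤ e / n := (Nat.le_div_iff_mul_le (by omega)).mpr (by omega)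
    have h2 : e % n < n := Nat.mod_lt _ (by omega)
    have := y2' (e % n) _ (y1' (e / n - e % n) _ start)
    convert this using 2
    have h3 : (e / n - e % n) * n + e % n * (n + 1) = e := by
      have h4 : (e / n - e % n) * n + e % n * n = e / n * n := by
        rw [← Nat.add_mul]; congr 1; omega
      have h5 := Nat.div_add_mod' e n
      rw [Nat.mul_add, mul_one, ← add_assoc, h4, h5]
    rw [add_assoc, h3]
    omega
  have hsq : (n + 1) ^ 2 = n * n + 2 * n + 1 := by ring
  -- The path ends with `n → 0` and then `i` steps up. Since `i ≤ n`, at least `n² + n` steps remain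
  -- for reaching `n`, exactly what `late` needs.
  have := up i 0 ((n + 1) ^ 2 - 1 - i + 1) (by omega)
    (wrap _ (late ((n + 1) ^ 2 - 1 - i) (by omega))).1
  convert this using 2
  · omega
  · exact Fin.ext (by simp)

theorem baryc_tau_iterate {n : ℕ} (hn : 1 ≤ n) (a : Fin 2) (k : ℕ) (p : Gamma n) :
    baryc ((tau n a)^[k] p) = (B n a ^ k) *ᵥ baryc p := by
  induction k with
  | zero => simp
  | succ k ih =>
    rw [Function.iterate_succ_apply', baryc_tau hn, ih, Matrix.mulVec_mulVec, pow_succ']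

theorem baryDist_tau_le {n : ℕ} (hn : 1 ≤ n) (a : Fin 2) (p q : Gamma n) :
    baryDist (tau n a p) (tau n a q) ≤ baryDist p q := by
  have := l1_mulVec_le (B n a) 0 (B_nonneg a) (B_col_sum hn a) (baryc p - baryc q)
    (by simp [baryc_sum])
  simpa [baryDist, baryc_tau hn, Matrix.mulVec_sub] using this

/-- A high iterate of `τ₁` is a contraction. -/
theorem exists_contraction {n : ℕ} (hn : 1 ≤ n) : ∃ κ : ℝ, 0 ≤ κ ∧ κ < 1 ∧ ∀ p q : Gamma n,
    baryDist ((tau n 1)^[(n + 1) ^ 2] p) ((tau n 1)^[(n + 1) ^ 2] q) ≤ κ * baryDist p q := by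
  obtain ⟨x, -, hx⟩ := Finset.exists_min_image Finset.univ
    (fun x : Fin (n + 1) × Fin (n + 1) => (B n 1 ^ ((n + 1) ^ 2)) x.1 x.2) Finset.univ_nonempty
  set ε := (B n 1 ^ ((n + 1) ^ 2)) x.1 x.2
  have hε : 0 < ε := B_one_pow_pos hn _ _
  refine ⟨max 0 (1 - ((n + 1 : ℕ) : ℝ) * ε), le_max_left _ _, max_lt one_pos ?_, fun p q => ?_⟩
  · have : 0 < ((n + 1 : ℕ) : ℝ) * ε := by positivity
    linarith
  · have := l1_mulVec_le (B n 1 ^ ((n + 1) ^ 2)) ε (fun i j => hx (i, j) (Finset.mem_univ _))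
      (pow_col_sum (B_col_sum hn 1) _) (baryc p - baryc q) (by simp [baryc_sum])
    refine le_trans ?_ (mul_le_mul_of_nonneg_right (le_max_right _ _) (baryDist_nonneg p q))
    simpa only [baryDist, baryc_tau_iterate hn, Matrix.mulVec_sub, Pi.sub_apply] using this

/-- The interior of `Γ`. -/
def openGamma (n : ℕ) : Set (Gamma n) := {p | ∀ j, 0 < baryc p j}

theorem openGamma_subset {n : ℕ} : openGamma n ⊆ GammaO n := fun p hp => by
  have := hp 0
  rw [baryc_zero] at this
  exact mem_GammaO_iff.mpr (by linarith)

theorem tau_iterate_mem_openGamma {n : ℕ} (hn : 1 ≤ n) (p : Gamma n) :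
    (tau n 1)^[(n + 1) ^ 2] p ∈ openGamma n := by
  intro i
  rw [baryc_tau_iterate hn]
  obtain ⟨j, -, hj⟩ : ∃ j ∈ Finset.univ, 0 < baryc p j := by
    by_contra! h
    have := Finset.sum_nonpos h
    rw [baryc_sum] at this
    linarith
  exact Finset.sum_pos' (fun l _ => mul_nonneg (B_one_pow_pos hn _ _).le (baryc_nonneg p l))
    ⟨j, Finset.mem_univ _, mul_pos (B_one_pow_pos hn _ _) hj⟩

theorem tau_mem_openGamma {n : ℕ} (hn : 1 ≤ n) (a : Fin 2) {p : Gamma n} (hp : p ∈ openGamma n) :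
    tau n a p ∈ openGamma n := by
  intro i
  rw [baryc_tau hn]
  have hi := i.2
  obtain ⟨j, hj⟩ : ∃ j, 0 < B n a i j := by
    by_cases h : (i : ℕ) ≤ 1
    · refine ⟨Fin.last n, ?_⟩
      have h1 : (i : ℕ) = 0 ∨ (i : ℕ) = 1 := by omega
      simp only [B, Matrix.of_apply, Fin.val_last, if_true, h1]
      norm_num
    · refine ⟨⟨i - 1, by omega⟩, ?_⟩
      simp [B, show (i : ℕ) - 1 ≠ n by omega, show (i : ℕ) - 1 ≠ 0 by omega,
        show (i : ℕ) - 1 + 1 = i by omega]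
  exact Finset.sum_pos' (f := fun l => B n a i l * baryc p l)
    (fun l _ => mul_nonneg (B_nonneg _ _ _) (baryc_nonneg p l))
    ⟨j, Finset.mem_univ _, mul_pos hj (hp j)⟩

/-! ### The combinatorics of `τ₀`, `τ₁` and `K` -/

theorem tau_eq_of_notMem {n : ℕ} {p : Gamma n} (hp : p ∉ GammaO n) :
    tau n 0 p = tau n 1 p := by
  apply Subtype.ext
  rw [tau_val, tau_val]
  funext i
  simp only [tauFormula, coord_zero_of_notMem hp]
  norm_num

/-- The last coordinate of an image is only the common shift, because `β_{n+1} = 0`. Subtracting it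
recovers `β₂, …, βₙ`, and the shift then determines `β₁`. The hyperplane `α₁ + αₙ = 1` separates the
two halves. -/
theorem exists_tau_eq {n : ℕ} (hn : 1 ≤ n) (a : Fin 2) (p : Gamma n)
    (h : if a = 0 then coord p.1 0 + coord p.1 (n - 1) ≤ 1
      else 1 ≤ coord p.1 0 + coord p.1 (n - 1)) :
    ∃ q, tau n a q = p ∧
      coord q.1 0 = if a = 0 then coord p.1 0 + coord p.1 (n - 1)
        else 2 - coord p.1 0 - coord p.1 (n - 1) := by
  obtain ⟨h1, h2⟩ := coord_of_mem p.2
  set c := coord p.1 with hc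
  set β : ℕ → ℝ := fun k => if k = 0 then (if a = 0 then c 0 + c (n - 1)
    else 2 - c 0 - c (n - 1)) else c (k - 1) - c (n - 1) with hβ
  have hβ0 : β 0 = if a = 0 then c 0 + c (n - 1) else 2 - c 0 - c (n - 1) := by simp [hβ]
  have hβs : ∀ k, β (k + 1) = c k - c (n - 1) := fun k => by simp [hβ]
  have hanti : ∀ k l, k ≤ l → β l ≤ β k := by
    intro k l hkl
    rcases l with _ | l
    · rw [Nat.le_zero.mp hkl]
    rcases k with _ | k
    · rw [hβ0, hβs]
      have := h2 (Nat.zero_le l)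
      have := h1 (n - 1)
      have := h1 0
      split_ifs at h ⊢ <;> linarith
    · rw [hβs, hβs]
      have := h2 (Nat.le_of_succ_le_succ hkl)
      linarith
  have hle : β 0 ≤ 1 := by
    rw [hβ0]; split_ifs at h ⊢ <;> linarith
  have hq : (fun i : Fin n => β i) ∈ Gamma n := by
    refine ⟨fun i => ⟨?_, (hanti 0 i (Nat.zero_le _)).trans hle⟩, fun i j hij => hanti i j hij⟩
    refine le_trans ?_ (hanti i n i.2.le)
    obtain ⟨m, rfl⟩ : ∃ m, n = m + 1 := ⟨n - 1, by omega⟩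
    rw [hβs]
    simp
  have hcq : ∀ k, k ≤ n → coord (fun i : Fin n => β i) k = β k := by
    intro k hk
    rcases hk.lt_or_eq with h | rfl
    · simp [coord, h]
    · obtain ⟨m, rfl⟩ : ∃ m, k = m + 1 := ⟨k - 1, by omega⟩
      rw [hβs]
      simp [coord]
  refine ⟨⟨_, hq⟩, ?_, (hcq 0 (by omega)).trans hβ0⟩
  apply Subtype.ext
  rw [tau_val]
  funext i
  have hi : p.1 i = c i := by simp [hc, coord]
  simp only [tauFormula]
  rw [hcq _ i.2, hcq 0 (by omega), hcq 1 hn, hβ0, hβs, hβs 0, hi]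
  split_ifs <;> ring

theorem tau_cases {n : ℕ} (hn : 1 ≤ n) (p : Gamma n) :
    (∃ q ∈ GammaO n, tau n 0 q = p) ∨ ∃ q, tau n 1 q = p := by
  rcases lt_or_ge (coord p.1 0 + coord p.1 (n - 1)) 1 with h | h
  · obtain ⟨q, hq, h0⟩ := exists_tau_eq hn 0 p (by simpa using h.le)
    exact Or.inl ⟨q, mem_GammaO_iff.mpr (by simpa [h0] using h), hq⟩
  · obtain ⟨q, hq, -⟩ := exists_tau_eq hn 1 p (by simpa using h)
    exact Or.inr ⟨q, hq⟩

/-- The common face of the two halves may be assigned to either of them, because `τ₀ = τ₁` off `Γ°`.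
-/
theorem tau_cases' {n : ℕ} (hn : 1 ≤ n) (p : Gamma n) :
    (∃ q ∈ GammaO n, tau n 1 q = p) ∨ ∃ q, tau n 0 q = p := by
  rcases tau_cases hn p with ⟨q, -, hq⟩ | ⟨q, hq⟩
  · exact Or.inr ⟨q, hq⟩
  · by_cases h : q ∈ GammaO n
    · exact Or.inl ⟨q, h, hq⟩
    · exact Or.inr ⟨q, (tau_eq_of_notMem h).trans hq⟩

theorem tau_zero_ne_tau_one' {n : ℕ} (hn : 1 ≤ n) (p : Gamma n) {q : Gamma n}
    (hq : q ∈ GammaO n) : tau n 0 p ≠ tau n 1 q := by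
  intro h
  by_cases hp : p ∈ GammaO n
  · exact tau_zero_ne_tau_one hn hp q h
  · rw [tau_eq_of_notMem hp] at h
    exact hp (tau_injective hn 1 h ▸ hq)

theorem tau_zero_vZero {n : ℕ} : tau n 0 (vZero n) = vZero n := by
  apply Subtype.ext
  rw [tau_val]
  funext i
  simp [tauFormula, vZero, coord]

theorem exists_iterate_of_ne {n : ℕ} {a b : Fin 2}
    (hcase : ∀ p : Gamma n, (∃ q ∈ GammaO n, tau n b q = p) ∨ ∃ q, tau n a q = p) (k : ℕ)
    (p : Gamma n) : (∃ l, ∃ q ∈ GammaO n, (tau n a)^[l] (tau n b q) = p) ∨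
      ∃ q, (tau n a)^[k] q = p := by
  induction k with
  | zero => exact Or.inr ⟨p, rfl⟩
  | succ k ih =>
    rcases ih with h | ⟨q, rfl⟩
    · exact Or.inl h
    rcases hcase q with ⟨r, hr, rfl⟩ | ⟨r, rfl⟩
    · exact Or.inl ⟨k, r, hr, rfl⟩
    · exact Or.inr ⟨r, rfl⟩

/-- A point from which `τ₁` can be peeled off indefinitely lies in every `τ₁ᵏ Γ`; these sets shrink
to the fixed point `v₋₁` by contraction. -/
theorem eq_vNegOne_or {n : ℕ} (hn : 1 ≤ n) (p : Gamma n) :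
    p = vNegOne n ∨ ∃ k, ∃ q ∈ GammaO n, (tau n 1)^[k] (tau n 0 q) = p := by
  by_contra! h
  obtain ⟨κ, h0, h1, hκ⟩ := exists_contraction hn
  have hall : ∀ k, ∃ q, (tau n 1)^[k] q = p := fun k => by
    rcases exists_iterate_of_ne (tau_cases hn) k p with ⟨l, q, hq, hl⟩ | h'
    · exact absurd hl (h.2 l q hq)
    · exact h'
  have hfix := tau_one_vNegOne hn
  have hb : ∀ k q, baryDist ((tau n 1)^[(n + 1) ^ 2 * k] q) (vNegOne n) ≤ κ ^ k * 2 := by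
    intro k
    induction k with
    | zero => intro q; simpa using baryDist_le_two _ _
    | succ k ih =>
      intro q
      rw [mul_add, mul_one, add_comm, Function.iterate_add_apply]
      conv_lhs => rw [← Function.iterate_fixed hfix ((n + 1) ^ 2)]
      refine (hκ _ _).trans ?_
      rw [pow_succ' κ, mul_assoc]
      exact mul_le_mul_of_nonneg_left (ih q) h0
  have hd : ∀ k, dist p (vNegOne n) ≤ κ ^ k * 2 := fun k => by
    obtain ⟨q, hq⟩ := hall ((n + 1) ^ 2 * k)
    rw [← hq]
    exact (dist_le_baryDist _ _).trans (hb k q)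
  have hlim : Tendsto (fun k : ℕ => κ ^ k * 2) atTop (𝓝 0) := by
    simpa using (tendsto_pow_atTop_nhds_zero_of_lt_one h0 h1).mul_const 2
  exact h.1 (dist_le_zero.mp (ge_of_tendsto' hlim hd))

/-- A Lyapunov function for `τ₀`. -/
noncomputable def height {n : ℕ} (p : Gamma n) : ℝ :=
  n * coord p.1 0 + ∑ k ∈ Finset.range n, coord p.1 k

/-- The shift removes the first coordinate from the sum. The weight `n` is the one for which the
terms in `(β₁ - β₂) / 2` restore `n β₁` from `n β₂`. -/
theorem height_tau_zero {n : ℕ} (hn : 1 ≤ n) (p : Gamma n) :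
    height (tau n 0 p) = height p - coord p.1 0 := by
  have hc : ∀ k, k < n → coord (tau n 0 p).1 k =
      coord p.1 (k + 1) + (coord p.1 0 - coord p.1 1) / 2 := by
    intro k hk
    rw [tau_val]
    simp [coord, hk, tauFormula]
  have hz : coord p.1 n = 0 := by simp [coord]
  rw [height, height, hc 0 (by omega),
    Finset.sum_congr rfl fun k hk => hc k (Finset.mem_range.mp hk), Finset.sum_add_distrib]
  have := Finset.sum_range_succ' (coord p.1) n
  rw [Finset.sum_range_succ, hz, add_zero] at this
  rw [this]
  simp only [Finset.sum_const, Finset.card_range, nsmul_eq_mul, zero_add]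
  ring

/-- Column `0` of `B₀` is `e₀`, so no power of `B₀` is positive and the contraction argument for
`τ₁` is unavailable. Instead `height` decreases under `τ₀` at a definite rate, so a point with
preimages under every `τ₀ᵏ` has height `0`. -/
theorem eq_vZero_or {n : ℕ} (hn : 1 ≤ n) (p : Gamma n) :
    p = vZero n ∨ ∃ k, ∃ q ∈ GammaO n, (tau n 0)^[k] (tau n 1 q) = p := by
  by_contra! h
  have hall : ∀ k, ∃ q, (tau n 0)^[k] q = p := fun k => by
    rcases exists_iterate_of_ne (tau_cases' hn) k p with ⟨l, q, hq, hl⟩ | h'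
    · exact absurd hl (h.2 l q hq)
    · exact h'
  have hup : ∀ q : Gamma n, height q ≤ 2 * n * coord q.1 0 := by
    intro q
    have : ∑ k ∈ Finset.range n, coord q.1 k ≤ ∑ k ∈ Finset.range n, coord q.1 0 :=
      Finset.sum_le_sum fun k _ => (coord_of_mem q.2).2 (Nat.zero_le k)
    simp only [Finset.sum_const, Finset.card_range, nsmul_eq_mul] at this
    rw [height]
    linarith
  have hn' : (0 : ℝ) < n := by exact_mod_cast hn
  have h0 : ∀ q : Gamma n, 0 ≤ coord q.1 0 := fun q => ((coord_of_mem q.2).1 0).1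
  -- Each step lowers the height by the first coordinate, which by `hup` is at least `1 / (2 n)` of
  -- the current height and hence of the final one.
  have hgrow : ∀ k q, height ((tau n 0)^[k] q) ≤ height q ∧
      height ((tau n 0)^[k] q) * (1 + k / (2 * n)) ≤ height q := by
    intro k
    induction k with
    | zero => intro q; simp
    | succ k ih =>
      intro q
      rw [Function.iterate_succ_apply]
      obtain ⟨i1, i2⟩ := ih (tau n 0 q)
      rw [height_tau_zero hn] at i1 i2
      have h1 := h0 q
      have h2 := hup q
      refine ⟨by linarith, ?_⟩
      have h3 : height ((tau n 0)^[k] (tau n 0 q)) * (1 / (2 * n)) ≤ coord q.1 0 := by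
        rw [mul_one_div, div_le_iff₀ (by positivity)]
        linarith
      push_cast
      rw [add_div, ← add_assoc, mul_add]
      linarith
  have hpos : 0 < height p := by
    have hc0 : 0 < coord p.1 0 := by
      refine lt_of_le_of_ne (h0 p) fun h' => h.1 (Subtype.ext (funext fun i => ?_))
      have h1 := (coord_of_mem p.2).2 (Nat.zero_le i)
      have h2 : coord p.1 i = p.1 i := by simp [coord]
      rw [← h', h2] at h1
      exact le_antisymm h1 (p.2.1 i).1
    have : 0 ≤ ∑ k ∈ Finset.range n, coord p.1 k :=
      Finset.sum_nonneg fun k _ => ((coord_of_mem p.2).1 k).1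
    rw [height]
    positivity
  -- This `k` makes `height p * (k / (2 n))` exceed `2 n`, the largest possible height.
  obtain ⟨k, hk⟩ := exists_nat_gt (2 * n / height p * (2 * n))
  obtain ⟨q, hq⟩ := hall k
  have h1 := (hgrow k q).2
  rw [hq] at h1
  have h2 := hup q
  have h3 := ((coord_of_mem q.2).1 0).2
  have h4 : 2 * n / height p < k / (2 * n) := by rwa [lt_div_iff₀ (by positivity)]
  rw [div_lt_iff₀ hpos] at h4
  nlinarith

theorem K_tau_zero {n : ℕ} (hn : 1 ≤ n) {q : Gamma n} (hq : q ∈ GammaO n) :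
    K n (tau n 0 q) = tau n 1 q := K_tau hn 0 hq

/-- The carry rule: another `τ₁` in front of the argument puts another `τ₀` in front of the value.
At `v₋₁` it reads `v₀ = τ₀ v₀`. -/
theorem K_tau_one {n : ℕ} (hn : 1 ≤ n) (q : Gamma n) : K n (tau n 1 q) = tau n 0 (K n q) := by
  rcases eq_vNegOne_or hn q with rfl | ⟨k, r, hr, rfl⟩
  · rw [tau_one_vNegOne hn, K_vNegOne hn, tau_zero_vZero]
  · rw [← Function.iterate_succ_apply' (tau n 1), K_tau hn _ hr, K_tau hn _ hr,
      Function.iterate_succ_apply']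

theorem K_surjective {n : ℕ} (hn : 1 ≤ n) : Function.Surjective (K n) := by
  intro p
  rcases eq_vZero_or hn p with rfl | ⟨k, q, hq, rfl⟩
  · exact ⟨_, K_vNegOne hn⟩
  · exact ⟨_, K_tau hn k hq⟩

theorem K_injective {n : ℕ} (hn : 1 ≤ n) : Function.Injective (K n) := by
  have uniq : ∀ (k l : ℕ) (q r : Gamma n), q ∈ GammaO n → r ∈ GammaO n →
      (tau n 0)^[k] (tau n 1 q) = (tau n 0)^[l] (tau n 1 r) → k = l ∧ q = r := by
    intro k
    induction k with
    | zero =>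
      intro l q r hq hr h
      rcases l with _ | l
      · exact ⟨rfl, tau_injective hn 1 h⟩
      · rw [Function.iterate_succ_apply'] at h
        exact absurd h.symm (tau_zero_ne_tau_one' hn _ hq)
    | succ k ih =>
      intro l q r hq hr h
      rcases l with _ | l
      · rw [Function.iterate_succ_apply'] at h
        exact absurd h (tau_zero_ne_tau_one' hn _ hr)
      · rw [Function.iterate_succ_apply', Function.iterate_succ_apply'] at h
        obtain ⟨h1, h2⟩ := ih l q r hq hr (tau_injective hn 0 h)
        exact ⟨by rw [h1], h2⟩
  have hne : ∀ (k : ℕ) (q : Gamma n), q ∈ GammaO n → (tau n 0)^[k] (tau n 1 q) ≠ vZero n := by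
    intro k q hq h
    have hv := Function.iterate_fixed (tau_zero_vZero (n := n)) k
    rw [← hv] at h
    have h' := (tau_injective hn 0).iterate k h
    rw [← tau_zero_vZero] at h'
    exact tau_zero_ne_tau_one' hn _ hq h'.symm
  intro p p' h
  rcases eq_vNegOne_or hn p with rfl | ⟨k, q, hq, rfl⟩ <;>
    rcases eq_vNegOne_or hn p' with rfl | ⟨l, r, hr, rfl⟩
  · rfl
  · rw [K_vNegOne hn, K_tau hn l hr] at h
    exact absurd h.symm (hne _ _ hr)
  · rw [K_vNegOne hn, K_tau hn k hq] at h
    exact absurd h (hne _ _ hq)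
  · rw [K_tau hn k hq, K_tau hn l hr] at h
    obtain ⟨rfl, rfl⟩ := uniq _ _ _ _ hq hr h
    rfl

/-! ### Normalized Lebesgue measure -/

theorem tau_continuous {n : ℕ} (a : Fin 2) : Continuous (tau n a) := by
  have hc : ∀ k, Continuous fun p : Gamma n => coord p.1 k := by
    intro k
    by_cases h : k < n
    · simp only [coord, h, dif_pos]
      exact (continuous_apply _).comp continuous_subtype_val
    · simp only [coord, h, dif_neg, not_false_eq_true]
      exact continuous_const
  refine Continuous.subtype_mk (continuous_pi fun i => ?_) _
  simp only [tauFun_eq, tauFormula]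
  refine (hc _).add (Continuous.div_const ?_ _)
  split_ifs
  · exact (hc 0).sub (hc 1)
  · exact (continuous_const.sub (hc 0)).sub (hc 1)

theorem Gamma_isCompact (n : ℕ) : IsCompact (Gamma n) := by
  have hcl : IsClosed (Gamma n) := by
    have : Gamma n = (⋂ i : Fin n, {p : Fin n → ℝ | 0 ≤ p i ∧ p i ≤ 1}) ∩
        ⋂ i : Fin n, ⋂ j : Fin n, ⋂ _ : i ≤ j, {p : Fin n → ℝ | p j ≤ p i} := by
      ext p
      simp [Gamma, Antitone]
    rw [this]
    refine (isClosed_iInter fun i => ?_).inter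
      (isClosed_iInter fun i => isClosed_iInter fun j => isClosed_iInter fun _ => ?_)
    · exact (isClosed_le continuous_const (continuous_apply i)).inter
        (isClosed_le (continuous_apply i) continuous_const)
    · exact isClosed_le (continuous_apply j) (continuous_apply i)
  refine (isCompact_Icc (a := (0 : Fin n → ℝ)) (b := 1)).of_isClosed_subset hcl fun p hp => ?_
  exact ⟨fun i => (hp.1 i).1, fun i => (hp.1 i).2⟩

instance (n : ℕ) : CompactSpace (Gamma n) := isCompact_iff_compactSpace.mp (Gamma_isCompact n)

theorem tau_measurableEmbedding {n : ℕ} (hn : 1 ≤ n) (a : Fin 2) :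
    MeasurableEmbedding (tau n a) :=
  ((tau_continuous a).isClosedEmbedding (tau_injective hn a)).measurableEmbedding

theorem volume_Gamma_ne_top (n : ℕ) : volume (Gamma n) ≠ ⊤ := (Gamma_isCompact n).measure_lt_top.ne

theorem volume_Gamma_ne_zero (n : ℕ) : volume (Gamma n) ≠ 0 := by
  -- An open box whose sides are disjoint intervals in decreasing order, so that the ordering of the
  -- coordinates is automatic.
  set S : Set (Fin n → ℝ) := Set.univ.pi fun i : Fin n =>
    Set.Ioo (((n : ℝ) - i) / (n + 1) - 1 / (2 * (n + 1))) (((n : ℝ) - i) / (n + 1))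
  have hS : S ⊆ Gamma n := by
    intro p hp
    have h : ∀ i : Fin n, ((n : ℝ) - i - 1 / 2) / (n + 1) < p i ∧ p i < ((n : ℝ) - i) / (n + 1) := by
      intro i
      obtain ⟨h1, h2⟩ := hp i trivial
      refine ⟨lt_of_eq_of_lt ?_ h1, h2⟩
      field_simp
    refine ⟨fun i => ⟨?_, ?_⟩, fun i j hij => ?_⟩
    · refine le_trans (div_nonneg ?_ (by positivity)) (h i).1.le
      have : ((i : ℕ) : ℝ) + 1 ≤ n := by exact_mod_cast i.2
      linarith
    · refine (h i).2.le.trans ?_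
      rw [div_le_one (by positivity)]
      have : (0 : ℝ) ≤ (i : ℕ) := by positivity
      linarith
    · rcases hij.eq_or_lt with rfl | hlt
      · rfl
      · refine (h j).2.le.trans (le_trans ?_ (h i).1.le)
        have : ((i : ℕ) : ℝ) + 1 ≤ (j : ℕ) := by exact_mod_cast hlt
        exact div_le_div_of_nonneg_right (by linarith) (by positivity)
  have hopen : IsOpen S := isOpen_set_pi Set.finite_univ fun _ _ => isOpen_Ioo
  have hne : S.Nonempty := by
    rw [Set.univ_pi_nonempty_iff]
    intro i
    rw [Set.nonempty_Ioo]
    have : (0 : ℝ) < 1 / (2 * (n + 1)) := by positivity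
    linarith
  exact fun h0 => (hopen.measure_pos volume hne).ne' (measure_mono_null hS h0)

theorem lam_apply {n : ℕ} (s : Set (Gamma n)) :
    lam n s = (volume (Gamma n))⁻¹ * volume (Subtype.val '' s) := by
  rw [lam, Measure.smul_apply, smul_eq_mul,
    (MeasurableEmbedding.subtype_coe (Gamma_isCompact n).measurableSet).comap_apply]

instance (n : ℕ) : IsProbabilityMeasure (lam n) := ⟨by
  rw [lam_apply, Set.image_univ, Subtype.range_coe,
    ENNReal.inv_mul_cancel (volume_Gamma_ne_zero n) (volume_Gamma_ne_top n)]⟩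

/-- The linear map `τ₀`. -/
noncomputable def tauLinear (n : ℕ) : (Fin n → ℝ) →ₗ[ℝ] (Fin n → ℝ) where
  toFun := tauFormula n 0
  map_add' p q := by
    have hc : ∀ k, coord (p + q) k = coord p k + coord q k := by
      intro k; unfold coord; split_ifs <;> simp
    funext i
    simp only [tauFormula, hc, if_true, Pi.add_apply]
    ring
  map_smul' c p := by
    have hc : ∀ k, coord (c • p) k = c * coord p k := by
      intro k; unfold coord; split_ifs <;> simp
    funext i
    simp only [tauFormula, hc, if_true, Pi.smul_apply, RingHom.id_apply, smul_eq_mul]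
    ring

/-- The reflection of the first coordinate at `1`. -/
noncomputable def reflect (n : ℕ) (p : Fin n → ℝ) : Fin n → ℝ :=
  fun i => if (i : ℕ) = 0 then 2 - p i else p i

theorem reflect_reflect {n : ℕ} (p : Fin n → ℝ) : reflect n (reflect n p) = p := by
  funext i
  simp only [reflect]
  split_ifs <;> ring

theorem reflect_measurePreserving (n : ℕ) :
    MeasurePreserving (reflect n) (volume : Measure (Fin n → ℝ)) volume :=
  volume_preserving_pi (f := fun (i : Fin n) (x : ℝ) => if (i : ℕ) = 0 then 2 - x else x) fun i => by
    by_cases h : (i : ℕ) = 0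
    · simp only [h, if_true]
      exact Measure.measurePreserving_sub_left volume 2
    · simp only [h, if_false]
      exact MeasurePreserving.id _

theorem tauFormula_one {n : ℕ} (p : Fin n → ℝ) :
    tauFormula n 1 p = tauFormula n 0 (reflect n p) := by
  have hs : ∀ k, coord (reflect n p) (k + 1) = coord p (k + 1) := by
    intro k; simp [coord, reflect]
  funext i
  have h0 : coord (reflect n p) 0 = 2 - coord p 0 := by
    simp [coord, reflect, show 0 < n from (Nat.zero_le _).trans_lt i.2]
  simp only [tauFormula, hs, h0]
  norm_num

/-- `τ₁` is `τ₀` after a volume-preserving reflection, so one constant serves both. Its value is not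
needed here: total mass forces it to be `1 / 2` in `lam_image_tau`. -/
theorem exists_scale (n : ℕ) : ∃ c : ENNReal, ∀ (a : Fin 2) (s : Set (Fin n → ℝ)),
    MeasurableSet s → volume (tauFormula n a '' s) = c * volume s := by
  have h0 : ∀ s : Set (Fin n → ℝ), volume (tauFormula n 0 '' s) =
      ENNReal.ofReal |LinearMap.det (tauLinear n)| * volume s := fun s =>
    Measure.addHaar_image_linearMap volume (tauLinear n) s
  refine ⟨ENNReal.ofReal |LinearMap.det (tauLinear n)|, fun a s hs => ?_⟩
  fin_cases a
  · exact h0 s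
  · have h1 : tauFormula n 1 '' s = tauFormula n 0 '' (reflect n '' s) := by
      rw [Set.image_image]
      exact Set.image_congr fun p _ => tauFormula_one p
    have h2 : reflect n '' s = reflect n ⁻¹' s :=
      Set.image_eq_preimage_of_inverse reflect_reflect reflect_reflect ▸ rfl
    change volume (tauFormula n 1 '' s) = _
    rw [h1, h0, h2, (reflect_measurePreserving n).measure_preimage hs.nullMeasurableSet]

theorem lam_compl_GammaO {n : ℕ} (hn : 1 ≤ n) : lam n (GammaO n)ᶜ = 0 := by
  rw [lam_apply]
  refine mul_eq_zero_of_right _ (measure_mono_null ?_ (Measure.pi_hyperplane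
    (fun _ : Fin n => (volume : Measure ℝ)) ⟨0, hn⟩ 1))
  rintro _ ⟨p, hp, rfl⟩
  have := coord_zero_of_notMem hp
  simpa [coord, show 0 < n from hn] using this

theorem GammaO_measurableSet (n : ℕ) : MeasurableSet (GammaO n) := by
  have hc : Measurable fun p : Gamma n => coord p.1 0 := by
    by_cases h : 0 < n
    · simp only [coord, h, dif_pos]
      exact (measurable_pi_apply _).comp measurable_subtype_coe
    · simp only [coord, h, dif_neg, not_false_eq_true]
      exact measurable_const
  have : GammaO n = {p | coord p.1 0 < 1} := Set.ext fun p => mem_GammaO_iff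
  rw [this]
  exact measurableSet_lt hc measurable_const

theorem exists_lam_scale (n : ℕ) : ∃ c : ENNReal, ∀ (a : Fin 2) (s : Set (Gamma n)),
    MeasurableSet s → lam n (tau n a '' s) = c * lam n s := by
  obtain ⟨c, hc⟩ := exists_scale n
  refine ⟨c, fun a s hs => ?_⟩
  have h : Subtype.val '' (tau n a '' s) = tauFormula n a '' (Subtype.val '' s) := by
    rw [Set.image_image, Set.image_image]
    exact Set.image_congr fun p _ => tau_val a p
  rw [lam_apply, lam_apply, h, hc _ _
    ((Gamma_isCompact n).measurableSet.subtype_image hs), mul_left_comm]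

theorem lam_split {n : ℕ} (hn : 1 ≤ n) {s : Set (Gamma n)} (hs : MeasurableSet s) :
    lam n s = lam n (s ∩ Set.range (tau n 0)) + lam n (s ∩ Set.range (tau n 1)) := by
  obtain ⟨c, hc⟩ := exists_lam_scale n
  have hU : s = (s ∩ Set.range (tau n 0)) ∪ (s ∩ Set.range (tau n 1)) := by
    rw [← Set.inter_union_distrib_left, eq_comm, Set.inter_eq_left]
    intro p _
    rcases tau_cases hn p with ⟨q, -, hq⟩ | ⟨q, hq⟩
    · exact Or.inl ⟨q, hq⟩
    · exact Or.inr ⟨q, hq⟩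
  conv_lhs => rw [hU]
  refine measure_union₀
    (hs.inter (tau_measurableEmbedding hn 1).measurableSet_range).nullMeasurableSet ?_
  -- The two halves overlap only in the `τ₀`-image of the null face `α₁ = 1`.
  refine measure_mono_null (t := tau n 0 '' (GammaO n)ᶜ) ?_ ?_
  · rintro p ⟨⟨-, q, rfl⟩, ⟨-, r, hr⟩⟩
    exact ⟨q, fun hq => tau_zero_ne_tau_one hn hq r hr.symm, rfl⟩
  · rw [hc _ _ (GammaO_measurableSet n).compl, lam_compl_GammaO hn, mul_zero]

theorem lam_image_tau {n : ℕ} (hn : 1 ≤ n) (a : Fin 2) {s : Set (Gamma n)}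
    (hs : MeasurableSet s) : 2 * lam n (tau n a '' s) = lam n s := by
  obtain ⟨c, hc⟩ := exists_lam_scale n
  have h := lam_split hn MeasurableSet.univ
  rw [Set.univ_inter, Set.univ_inter, ← Set.image_univ, ← Set.image_univ,
    hc _ _ MeasurableSet.univ, hc _ _ MeasurableSet.univ, measure_univ, mul_one] at h
  rw [hc _ _ hs, ← mul_assoc, two_mul, ← h, one_mul]

/-- Self-similarity of the normalized Lebesgue measure. -/
theorem two_smul_lam {n : ℕ} (hn : 1 ≤ n) :
    (2 : ENNReal) • lam n = (lam n).map (tau n 0) + (lam n).map (tau n 1) := by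
  ext s hs
  have h : ∀ a, lam n (tau n a ⁻¹' s) = 2 * lam n (s ∩ Set.range (tau n a)) := fun a => by
    rw [← lam_image_tau hn a ((tau_measurableEmbedding hn a).measurable hs),
      Set.image_preimage_eq_inter_range]
  rw [Measure.smul_apply, Measure.add_apply,
    Measure.map_apply (tau_measurableEmbedding hn 0).measurable hs,
    Measure.map_apply (tau_measurableEmbedding hn 1).measurable hs, h, h, smul_eq_mul,
    lam_split hn hs, mul_add]

/-! ### Invariance of the measure under `K` -/

theorem K_measurable {n : ℕ} (hn : 1 ≤ n) : Measurable (K n) := by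
  have hm : ∀ a k, MeasurableEmbedding (tau n a)^[k] := by
    intro a k
    induction k with
    | zero => exact MeasurableEmbedding.id
    | succ k ih => exact ih.comp (tau_measurableEmbedding hn a)
  intro s hs
  have hK : K n ⁻¹' s = (⋃ k : ℕ, ((tau n 1)^[k] ∘ tau n 0) ''
      (GammaO n ∩ ((tau n 0)^[k] ∘ tau n 1) ⁻¹' s)) ∪ ({vNegOne n} ∩ {_p | vZero n ∈ s}) := by
    ext p
    constructor
    · intro hp
      rcases eq_vNegOne_or hn p with rfl | ⟨k, q, hq, rfl⟩
      · exact Or.inr ⟨rfl, by rw [Set.mem_preimage, K_vNegOne hn] at hp; exact hp⟩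
      · rw [Set.mem_preimage, K_tau hn k hq] at hp
        exact Or.inl (Set.mem_iUnion.mpr ⟨k, q, ⟨hq, hp⟩, rfl⟩)
    · rintro (h | ⟨rfl, h⟩)
      · obtain ⟨k, q, ⟨hq, hp⟩, rfl⟩ := Set.mem_iUnion.mp h
        rw [Set.mem_preimage, Function.comp_apply, K_tau hn k hq]
        exact hp
      · rw [Set.mem_preimage, K_vNegOne hn]
        exact h
  rw [hK]
  refine (MeasurableSet.iUnion fun k => ?_).union
    ((measurableSet_singleton _).inter (MeasurableSet.const _))
  exact ((hm 1 k).comp (tau_measurableEmbedding hn 0)).measurableSet_image.mpr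
    ((GammaO_measurableSet n).inter
      (((hm 0 k).comp (tau_measurableEmbedding hn 1)).measurable hs))

/-- Pushing `2λ = τ₀∗λ + τ₁∗λ` forward by `K` gives `2m = τ₁∗λ + τ₀∗m` for `m = K∗λ`. Subtracting,
`m - λ` is half of its own image under `τ₀`, so it vanishes by iteration. -/
theorem K_measurePreserving {n : ℕ} (hn : 1 ≤ n) : MeasurePreserving (K n) (lam n) (lam n) := by
  have hK := K_measurable hn
  have ht := fun a => (tau_measurableEmbedding (n := n) hn a).measurable
  refine ⟨hK, ?_⟩
  have : IsProbabilityMeasure ((lam n).map (K n)) := Measure.isProbabilityMeasure_map hK.aemeasurable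
  set m := (lam n).map (K n) with hm
  have hself : (2 : ENNReal) • m = (lam n).map (tau n 1) + m.map (tau n 0) := by
    rw [hm, ← Measure.map_smul, two_smul_lam hn, Measure.map_add _ _ hK,
      Measure.map_map hK (ht 0), Measure.map_map hK (ht 1), Measure.map_map (ht 0) hK]
    congr 1
    · refine Measure.map_congr ?_
      have : ∀ᵐ p ∂lam n, p ∈ GammaO n := by
        rw [ae_iff]; exact lam_compl_GammaO hn
      filter_upwards [this] with p hp using K_tau_zero hn hp
    · congr 1
      funext p
      exact K_tau_one hn p
  have hstep : ∀ s, MeasurableSet s → m.real s - (lam n).real s =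
      (m.real (tau n 0 ⁻¹' s) - (lam n).real (tau n 0 ⁻¹' s)) / 2 := by
    intro s hs
    have h1 := congrArg (fun μ => ENNReal.toReal (μ s)) hself
    have h2 := congrArg (fun μ => ENNReal.toReal (μ s)) (two_smul_lam hn)
    simp only [Measure.smul_apply, Measure.add_apply, Measure.map_apply (ht _) hs, smul_eq_mul,
      ENNReal.toReal_mul, ENNReal.toReal_add (measure_ne_top _ _) (measure_ne_top _ _),
      ENNReal.toReal_ofNat] at h1 h2
    simp only [measureReal_def]
    linarith
  have hb : ∀ (k : ℕ) s, MeasurableSet s → |m.real s - (lam n).real s| ≤ (1 / 2) ^ k := by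
    intro k
    induction k with
    | zero =>
      intro s _
      have h1 : m.real s ≤ 1 := measureReal_le_one
      have h2 : (lam n).real s ≤ 1 := measureReal_le_one
      have h3 : 0 ≤ m.real s := measureReal_nonneg
      have h4 : 0 ≤ (lam n).real s := measureReal_nonneg
      rw [pow_zero, abs_le]
      constructor <;> linarith
    | succ k ih =>
      intro s hs
      have := ih _ (ht 0 hs)
      rw [hstep s hs, abs_div, pow_succ, abs_of_pos (two_pos : (0 : ℝ) < 2)]
      linarith
  ext s hs
  have hlim := tendsto_pow_atTop_nhds_zero_of_lt_one (r := (1 / 2 : ℝ)) (by norm_num) (by norm_num)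
  have h0 : |m.real s - (lam n).real s| ≤ 0 := ge_of_tendsto' hlim fun k => hb k s hs
  have h1 := sub_eq_zero.mp (abs_nonpos_iff.mp h0)
  exact (ENNReal.toReal_eq_toReal_iff' (measure_ne_top _ _) (measure_ne_top _ _)).mp h1

/-! ### The averaging operator -/

/-- The averaging operator `f ↦ (f ∘ τ₀ + f ∘ τ₁) / 2`. -/
noncomputable def avg (n : ℕ) (f : Gamma n → ℝ) (p : Gamma n) : ℝ :=
  (f (tau n 0 p) + f (tau n 1 p)) / 2

theorem avg_continuous {n : ℕ} {f : Gamma n → ℝ} (hf : Continuous f) : Continuous (avg n f) :=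
  ((hf.comp (tau_continuous 0)).add (hf.comp (tau_continuous 1))).div_const 2

theorem avg_iterate_continuous {n : ℕ} {f : Gamma n → ℝ} (hf : Continuous f) (t : ℕ) :
    Continuous ((avg n)^[t] f) := by
  induction t with
  | zero => exact hf
  | succ t ih => rw [Function.iterate_succ_apply']; exact avg_continuous ih

theorem integrable_of_continuous {n : ℕ} {m : Measure (Gamma n)} [IsFiniteMeasure m]
    {f : Gamma n → ℝ} (hf : Continuous f) : Integrable f m :=
  hf.integrable_of_hasCompactSupport (HasCompactSupport.of_compactSpace f)

theorem integral_avg {n : ℕ} (hn : 1 ≤ n) {f : Gamma n → ℝ} (hf : Continuous f) :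
    ∫ p, avg n f p ∂lam n = ∫ p, f p ∂lam n := by
  have ht := fun a => (tau_measurableEmbedding (n := n) hn a).measurable
  have := fun a => Measure.isProbabilityMeasure_map (μ := lam n) (ht a).aemeasurable
  have h := congrArg (fun μ => ∫ p, f p ∂μ) (two_smul_lam hn)
  simp only [integral_smul_measure] at h
  rw [integral_add_measure (integrable_of_continuous hf) (integrable_of_continuous hf),
    (tau_measurableEmbedding hn 0).integral_map, (tau_measurableEmbedding hn 1).integral_map] at h
  have h0 : Integrable (fun p => f (tau n 0 p)) (lam n) :=
    integrable_of_continuous (hf.comp (tau_continuous 0))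
  have h1 : Integrable (fun p => f (tau n 1 p)) (lam n) :=
    integrable_of_continuous (hf.comp (tau_continuous 1))
  simp only [avg]
  rw [integral_div, integral_add h0 h1, ← h]
  simp

theorem integral_avg_iterate {n : ℕ} (hn : 1 ≤ n) {f : Gamma n → ℝ} (hf : Continuous f) (t : ℕ) :
    ∫ p, (avg n)^[t] f p ∂lam n = ∫ p, f p ∂lam n := by
  induction t with
  | zero => rfl
  | succ t ih =>
    simp only [Function.iterate_succ_apply']
    rw [integral_avg hn (avg_iterate_continuous hf t), ih]

/-- Of the `2ᵗ` words of length `t`, all are nonexpansive, and the word `τ₁ᵗ`, of weight `2⁻ᵗ`, is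
kept apart because it contracts. The additive `e` is there because `f` is merely continuous, not
Lipschitz. -/
theorem avg_iterate_sub_le {n : ℕ} (hn : 1 ≤ n) {f : Gamma n → ℝ} {e C : ℝ} (hC : 0 ≤ C)
    (hf : ∀ p q, |f p - f q| ≤ e + C * baryDist p q) (t : ℕ) (p q : Gamma n) :
    |(avg n)^[t] f p - (avg n)^[t] f q| ≤ e + C * ((1 - (1 / 2) ^ t) * baryDist p q +
      (1 / 2) ^ t * baryDist ((tau n 1)^[t] p) ((tau n 1)^[t] q)) := by
  induction t generalizing p q with
  | zero => simpa using hf p q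
  | succ t ih =>
    simp only [Function.iterate_succ_apply']
    have h0 := ih (tau n 0 p) (tau n 0 q)
    have h1 := ih (tau n 1 p) (tau n 1 q)
    have d0 := baryDist_tau_le hn 0 p q
    have d1 := baryDist_tau_le hn 1 p q
    have dt : baryDist ((tau n 1)^[t] (tau n 0 p)) ((tau n 1)^[t] (tau n 0 q)) ≤
        baryDist p q := by
      have : ∀ k p q, baryDist ((tau n 1)^[k] p) ((tau n 1)^[k] q) ≤ baryDist p q := by
        intro k
        induction k with
        | zero => intro p q; exact le_rfl
        | succ k ih => intro p q; exact (ih _ _).trans (baryDist_tau_le hn 1 p q)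
      exact (this t _ _).trans d0
    rw [← Function.iterate_succ_apply, ← Function.iterate_succ_apply,
      Function.iterate_succ_apply', Function.iterate_succ_apply'] at h1
    set X := baryDist (tau n 1 ((tau n 1)^[t] p)) (tau n 1 ((tau n 1)^[t] q))
    set d := baryDist p q
    have hw : (0 : ℝ) ≤ (1 / 2) ^ t := by positivity
    have hw1 : (1 / 2 : ℝ) ^ t ≤ 1 := pow_le_one₀ (by norm_num) (by norm_num)
    set w := (1 / 2 : ℝ) ^ t
    have e0 : (1 - w) * baryDist (tau n 0 p) (tau n 0 q) +
        w * baryDist ((tau n 1)^[t] (tau n 0 p)) ((tau n 1)^[t] (tau n 0 q)) ≤ d := by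
      have := mul_le_mul_of_nonneg_left d0 (sub_nonneg.mpr hw1)
      have := mul_le_mul_of_nonneg_left dt hw
      linarith
    have e1 : (1 - w) * baryDist (tau n 1 p) (tau n 1 q) + w * X ≤ (1 - w) * d + w * X := by
      have := mul_le_mul_of_nonneg_left d1 (sub_nonneg.mpr hw1)
      linarith
    have g0 := h0.trans (add_le_add_right (mul_le_mul_of_nonneg_left e0 hC) e)
    have g1 := h1.trans (add_le_add_right (mul_le_mul_of_nonneg_left e1 hC) e)
    have hsplit : avg n ((avg n)^[t] f) p - avg n ((avg n)^[t] f) q =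
        (((avg n)^[t] f (tau n 0 p) - (avg n)^[t] f (tau n 0 q)) +
        ((avg n)^[t] f (tau n 1 p) - (avg n)^[t] f (tau n 1 q))) / 2 := by
      simp only [avg]; ring
    rw [hsplit, abs_div, abs_of_pos (two_pos : (0 : ℝ) < 2), pow_succ]
    have := abs_add_le ((avg n)^[t] f (tau n 0 p) - (avg n)^[t] f (tau n 0 q))
      ((avg n)^[t] f (tau n 1 p) - (avg n)^[t] f (tau n 1 q))
    change _ ≤ e + C * ((1 - w * (1 / 2)) * d + w * (1 / 2) * X)
    linarith

theorem avg_uniform_limit {n : ℕ} (hn : 1 ≤ n) {f : Gamma n → ℝ} (hf : Continuous f)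
    {ε : ℝ} (hε : 0 < ε) : ∃ t, ∀ p, |(avg n)^[t] f p - ∫ q, f q ∂lam n| ≤ ε := by
  obtain ⟨κ, -, h1, hκ⟩ := exists_contraction hn
  set T := (n + 1) ^ 2
  obtain ⟨δ, hδ, hu⟩ := Metric.uniformContinuous_iff.mp
    (CompactSpace.uniformContinuous_of_continuous hf) (ε / 2) (by positivity)
  obtain ⟨M, hM⟩ := (isCompact_range hf).isBounded.exists_norm_le
  have hM' : ∀ p, |f p| ≤ M := fun p => hM _ ⟨p, rfl⟩
  have hM0 : 0 ≤ M := (abs_nonneg _).trans (hM' (vZero n))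
  -- With this slope, uniform continuity covers distances below `δ` and the trivial bound `2 M`
  -- covers the others.
  set C := 2 * M / δ with hCdef
  have hC : 0 ≤ C := by positivity
  have hmod : ∀ p q, |f p - f q| ≤ ε / 2 + C * baryDist p q := by
    intro p q
    have hd := baryDist_nonneg p q
    rcases lt_or_ge (baryDist p q) δ with h | h
    · have := hu ((dist_le_baryDist p q).trans_lt h)
      rw [Real.dist_eq] at this
      have := mul_nonneg hC hd
      linarith
    · have h2 : 2 * M ≤ C * baryDist p q := by
        rw [hCdef, div_mul_eq_mul_div, le_div_iff₀ hδ]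
        exact mul_le_mul_of_nonneg_left h (by positivity)
      have := abs_sub (f p) (f q)
      linarith [hM' p, hM' q]
  set w := (1 / 2 : ℝ) ^ T with hwdef
  have hw : 0 < w := by positivity
  have hw1 : w ≤ 1 := pow_le_one₀ (by norm_num) (by norm_num)
  set θ := max 0 (1 - w * (1 - κ)) with hθ
  have hθ0 : 0 ≤ θ := le_max_left _ _
  have hθ1 : θ < 1 := max_lt one_pos (by nlinarith)
  -- The slope shrinks by `θ` at each stage, while the additive error `ε / 2` is passed on unchanged
  -- and does not accumulate.
  have hiter : ∀ k p q, |(avg n)^[T * k] f p - (avg n)^[T * k] f q| ≤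
      ε / 2 + (C * θ ^ k) * baryDist p q := by
    intro k
    induction k with
    | zero => simpa using hmod
    | succ k ih =>
      intro p q
      rw [mul_add, mul_one, add_comm, Function.iterate_add_apply]
      have hCk : 0 ≤ C * θ ^ k := by positivity
      refine (avg_iterate_sub_le hn hCk ih T p q).trans ?_
      have h2 : (1 - w) * baryDist p q + w * baryDist ((tau n 1)^[T] p) ((tau n 1)^[T] q) ≤
          θ * baryDist p q := by
        have := mul_le_mul_of_nonneg_left (hκ p q) hw.le
        have := mul_le_mul_of_nonneg_right (le_max_right 0 (1 - w * (1 - κ))) (baryDist_nonneg p q)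
        rw [hθ]
        linarith
      have := mul_le_mul_of_nonneg_left h2 hCk
      rw [pow_succ]
      linarith
  have hlim : Tendsto (fun k : ℕ => (C * θ ^ k) * 2) atTop (𝓝 0) := by
    simpa using ((tendsto_pow_atTop_nhds_zero_of_lt_one hθ0 hθ1).const_mul C).mul_const 2
  obtain ⟨k, hk⟩ := (hlim.eventually (ge_mem_nhds (half_pos hε))).exists
  refine ⟨T * k, fun p => ?_⟩
  have hcont := avg_iterate_continuous hf (T * k)
  have hosc : ∀ q, |(avg n)^[T * k] f p - (avg n)^[T * k] f q| ≤ ε := by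
    intro q
    have := mul_le_mul_of_nonneg_left (baryDist_le_two p q)
      (show 0 ≤ C * θ ^ k by positivity)
    linarith [hiter k p q]
  rw [← integral_avg_iterate hn hf (T * k)]
  have hconst : (avg n)^[T * k] f p - ∫ q, (avg n)^[T * k] f q ∂lam n =
      ∫ q, ((avg n)^[T * k] f p - (avg n)^[T * k] f q) ∂lam n := by
    rw [integral_sub (integrable_const _) (integrable_of_continuous hcont)]
    simp
  rw [hconst]
  have := norm_integral_le_of_norm_le_const (μ := lam n)
    (f := fun q => (avg n)^[T * k] f p - (avg n)^[T * k] f q) (Eventually.of_forall hosc)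
  simpa using this

/-! ### The transfer operator of the return to `τ₀ Γ` -/

open Classical in
/-- The sum of `f` over the `K`-orbit of `τ₀ q` until its return to `τ₀ Γ` at `τ₀ (K q)`. -/
noncomputable def tower (n : ℕ) {M : Type*} [AddCommMonoid M] (f : Gamma n → M) (q : Gamma n) : M :=
  if q ∈ GammaO n then f (tau n 0 q) + f (tau n 1 q) else f (tau n 1 q)

/-- `tower n 1` is the time taken from `τ₀ q` to `τ₀ (K q)`, so the orbit of `τ₀ q` is cut into
blocks indexed by the orbit of `q`. The codomain `M` is general because both times in `ℕ` and values
in `ℝ` are summed. -/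
theorem birkhoffSum_tau_zero {n : ℕ} (hn : 1 ≤ n) {M : Type*} [AddCommMonoid M] (f : Gamma n → M)
    (N : ℕ) (q : Gamma n) :
    (K n)^[birkhoffSum (K n) (tower n fun _ => 1) N q] (tau n 0 q) = tau n 0 ((K n)^[N] q) ∧
    birkhoffSum (K n) f (birkhoffSum (K n) (tower n fun _ => 1) N q) (tau n 0 q) =
      birkhoffSum (K n) (tower n f) N q := by
  induction N with
  | zero => simp
  | succ N ih =>
    obtain ⟨h1, h2⟩ := ih
    rw [birkhoffSum_succ, birkhoffSum_succ, birkhoffSum_add, h1, h2, add_comm _ (tower n _ _),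
      Function.iterate_add_apply, h1, Function.iterate_succ_apply']
    set r := (K n)^[N] q
    by_cases hr : r ∈ GammaO n
    · simp only [tower, if_pos hr, Nat.reduceAdd]
      simp [birkhoffSum, Finset.sum_range_succ, K_tau_zero hn hr, K_tau_one hn]
    · simp only [tower, if_neg hr]
      simp [birkhoffSum, tau_eq_of_notMem hr, K_tau_one hn]

theorem birkhoffSum_tau_zero_iterate {n : ℕ} (hn : 1 ≤ n) {M : Type*} [AddCommMonoid M] (t : ℕ)
    (f : Gamma n → M) (N : ℕ) (q : Gamma n) :
    birkhoffSum (K n) f (birkhoffSum (K n) ((tower n)^[t] fun _ => 1) N q) ((tau n 0)^[t] q) =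
      birkhoffSum (K n) ((tower n)^[t] f) N q := by
  induction t generalizing N q with
  | zero => simp [birkhoffSum]
  | succ t ih =>
    rw [Function.iterate_succ_apply' _ _ f, Function.iterate_succ_apply' _ _ fun _ => (1 : ℕ),
      Function.iterate_succ_apply, ← (birkhoffSum_tau_zero hn ((tower n)^[t] f) N q).2,
      ← (birkhoffSum_tau_zero hn ((tower n)^[t] fun _ => 1) N q).2, ih]

/-- One application of `K` moves `τ₁ Γ` into `τ₀ Γ`. The time needed by `q` to reach `τ₀ᵗ Γ` then
lifts, through the return times, to a time for `τ₀ q`. -/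
theorem exists_iterate_eq_tau_zero {n : ℕ} (hn : 1 ≤ n) (t : ℕ) (p : Gamma n) :
    ∃ i q, (K n)^[i] p = (tau n 0)^[t] q := by
  induction t generalizing p with
  | zero => exact ⟨0, p, rfl⟩
  | succ t ih =>
    obtain ⟨i, q, hq⟩ : ∃ i q, (K n)^[i] p = tau n 0 q := by
      rcases tau_cases hn p with ⟨q, -, rfl⟩ | ⟨q, rfl⟩
      · exact ⟨0, q, rfl⟩
      · exact ⟨1, K n q, K_tau_one hn q⟩
    obtain ⟨j, r, hr⟩ := ih q
    refine ⟨birkhoffSum (K n) (tower n fun _ => 1) j q + i, r, ?_⟩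
    rw [Function.iterate_add_apply, hq, (birkhoffSum_tau_zero hn (fun _ => (1 : ℕ)) j q).1, hr,
      Function.iterate_succ_apply']

theorem tower_monotone {n : ℕ} : Monotone (tower n (M := ℝ)) := by
  intro f g h q
  have h0 := h (tau n 0 q)
  have h1 := h (tau n 1 q)
  simp only [tower]
  split_ifs <;> linarith

theorem tower_iterate_linear {n : ℕ} (t : ℕ) (a b : ℝ) (f g : Gamma n → ℝ) :
    (tower n)^[t] (fun p => a * f p + b * g p) =
      fun p => a * (tower n)^[t] f p + b * (tower n)^[t] g p := by
  induction t with
  | zero => rfl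
  | succ t ih =>
    simp only [Function.iterate_succ_apply', ih]
    funext q
    simp only [tower]
    split_ifs <;> ring

theorem tower_iterate_const_mul {n : ℕ} (t : ℕ) (a : ℝ) (f : Gamma n → ℝ) :
    (tower n)^[t] (fun p => a * f p) = fun p => a * (tower n)^[t] f p := by
  simpa using tower_iterate_linear t a 0 f f

theorem abs_tower_iterate_le {n : ℕ} (t : ℕ) {f g : Gamma n → ℝ} (h : ∀ p, |f p| ≤ g p)
    (p : Gamma n) : |(tower n)^[t] f p| ≤ (tower n)^[t] g p := by
  have h1 := tower_monotone.iterate t (fun p => (abs_le.mp (h p)).2 : f ≤ g) p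
  have h2 := tower_monotone.iterate t
    (fun p => by have := (abs_le.mp (h p)).1; linarith : (fun p => (-1) * g p) ≤ f) p
  rw [tower_iterate_const_mul] at h2
  rw [abs_le]
  constructor <;> linarith

theorem tower_iterate_nonneg {n : ℕ} (t : ℕ) {f : Gamma n → ℝ} (h : ∀ p, 0 ≤ f p) (p : Gamma n) :
    0 ≤ (tower n)^[t] f p :=
  (abs_nonneg _).trans (abs_tower_iterate_le t (fun p => (abs_of_nonneg (h p)).le) p)

/-- The `τ₁` branch is never dropped from a tower, so the word `τ₁ᵗ` always contributes. -/
theorem le_tower_iterate {n : ℕ} (t : ℕ) {f : Gamma n → ℝ} (h : ∀ p, 0 ≤ f p) (p : Gamma n) :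
    f ((tau n 1)^[t] p) ≤ (tower n)^[t] f p := by
  induction t generalizing p with
  | zero => exact le_rfl
  | succ t ih =>
    rw [Function.iterate_succ_apply, Function.iterate_succ_apply']
    refine (ih _).trans ?_
    have := tower_iterate_nonneg t h (tau n 0 p)
    simp only [tower]
    split_ifs <;> linarith

theorem tower_iterate_one_le {n : ℕ} (t : ℕ) (p : Gamma n) :
    (tower n)^[t] (fun _ => (1 : ℝ)) p ≤ 2 ^ t := by
  induction t generalizing p with
  | zero => simp
  | succ t ih =>
    rw [Function.iterate_succ_apply', pow_succ]
    have h0 := ih (tau n 0 p)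
    have h1 := ih (tau n 1 p)
    have : (0 : ℝ) ≤ 2 ^ t := by positivity
    simp only [tower]
    split_ifs <;> linarith

theorem tower_iterate_natCast {n : ℕ} (t : ℕ) (p : Gamma n) :
    (((tower n)^[t] (fun _ => (1 : ℕ)) p : ℕ) : ℝ) = (tower n)^[t] (fun _ => (1 : ℝ)) p := by
  induction t generalizing p with
  | zero => simp
  | succ t ih =>
    simp only [Function.iterate_succ_apply', tower]
    split_ifs
    · rw [Nat.cast_add, ih, ih]
    · exact ih _

/-- The interior lies in `Γ°` and is preserved by `τ₀` and `τ₁`, so no word is ever missing. -/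
theorem tower_iterate_of_mem {n : ℕ} (hn : 1 ≤ n) (t : ℕ) (f : Gamma n → ℝ) {p : Gamma n}
    (hp : p ∈ openGamma n) : (tower n)^[t] f p = 2 ^ t * (avg n)^[t] f p := by
  induction t generalizing p with
  | zero => simp
  | succ t ih =>
    rw [Function.iterate_succ_apply', Function.iterate_succ_apply']
    simp only [tower, if_pos (openGamma_subset hp), avg]
    rw [ih (tau_mem_openGamma hn 0 hp), ih (tau_mem_openGamma hn 1 hp)]
    ring

/-- Most points of a long tower lie in the interior of `Γ`. -/
theorem exists_tower_compl_le {n : ℕ} (hn : 1 ≤ n) {ε : ℝ} (hε : 0 < ε) : ∃ s, ∀ p,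
    (tower n)^[s] ((openGamma n)ᶜ.indicator 1) p ≤
      ε * (tower n)^[s] ((openGamma n).indicator (1 : Gamma n → ℝ)) p := by
  set I := openGamma n
  set g : Gamma n → ℝ := I.indicator 1 with hg
  set h : Gamma n → ℝ := Iᶜ.indicator 1 with hh
  set T := (n + 1) ^ 2
  have hg0 : ∀ p, 0 ≤ g p := fun p => Set.indicator_nonneg (fun _ _ => zero_le_one) p
  have hh0 : ∀ p, 0 ≤ h p := fun p => Set.indicator_nonneg (fun _ _ => zero_le_one) p
  have hg1 : ∀ p, 1 ≤ (tower n)^[T] g p := fun p => by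
    refine le_trans ?_ (le_tower_iterate T hg0 p)
    rw [hg, Set.indicator_of_mem (tau_iterate_mem_openGamma hn p)]
    rfl
  have hsum : ∀ t p, (tower n)^[t] g p + (tower n)^[t] h p ≤ 2 ^ t := fun t p => by
    have := congrFun (tower_iterate_linear t 1 1 g h) p
    simp only [one_mul] at this
    rw [← this]
    refine le_of_eq_of_le ?_ (tower_iterate_one_le t p)
    refine congrFun (congrArg (tower n)^[t] (funext fun r => ?_)) p
    exact congrFun (Set.indicator_self_add_compl I (1 : Gamma n → ℝ)) r
  have hgI : ∀ t p, 2 ^ t * g p ≤ (tower n)^[t] g p := by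
    intro t
    induction t with
    | zero => intro p; simp
    | succ t ih =>
      intro p
      by_cases hp : p ∈ I
      · have h0 := ih (tau n 0 p)
        have h1 := ih (tau n 1 p)
        rw [hg, Set.indicator_of_mem (tau_mem_openGamma hn _ hp), ← hg] at h0 h1
        rw [Function.iterate_succ_apply', hg, Set.indicator_of_mem hp, ← hg]
        simp only [tower, if_pos (openGamma_subset hp), Pi.one_apply] at h0 h1 ⊢
        rw [pow_succ]
        linarith
      · rw [hg, Set.indicator_of_notMem hp, ← hg, mul_zero]
        exact tower_iterate_nonneg _ hg0 p
  set A : ℝ := 2 ^ T - 1 with hA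
  have hA0 : 0 ≤ A := sub_nonneg.mpr (one_le_pow₀ (by norm_num))
  -- Interior points produce no boundary points. A boundary point produces at most `2^T` points, and
  -- the one for `τ₁^T` is interior.
  have hT : (tower n)^[T] h ≤ fun p => A * h p := by
    intro p
    change (tower n)^[T] h p ≤ A * h p
    by_cases hp : p ∈ I
    · have h1 := hgI T p
      have h2 := hsum T p
      rw [hg, Set.indicator_of_mem hp, ← hg, Pi.one_apply, mul_one] at h1
      have h3 : h p = 0 := Set.indicator_of_notMem (Set.notMem_compl_iff.mpr hp) _
      rw [h3]
      linarith
    · have h1 := hg1 p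
      have h2 := hsum T p
      have h3 : h p = 1 := Set.indicator_of_mem (show p ∈ Iᶜ from hp) _
      rw [h3]
      linarith
  have hupper : ∀ k p, (tower n)^[T * k] h p ≤ A ^ k := by
    have : ∀ k p, (tower n)^[T * k] h p ≤ A ^ k * h p := by
      intro k
      induction k with
      | zero => intro p; simp
      | succ k ih =>
        intro p
        rw [mul_add, mul_one, Function.iterate_add_apply]
        refine (tower_monotone.iterate (T * k) hT p).trans ?_
        rw [tower_iterate_const_mul, pow_succ', mul_assoc]
        exact mul_le_mul_of_nonneg_left (ih p) hA0
    intro k p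
    refine (this k p).trans (mul_le_of_le_one_right (by positivity) ?_)
    exact Set.indicator_le' (fun _ _ => le_rfl) (fun _ _ => zero_le_one) p
  have hlower : ∀ k p, 2 ^ (T * k) ≤ (tower n)^[T * (k + 1)] g p := by
    intro k p
    have := tower_monotone.iterate T (hgI (T * k)) p
    rw [tower_iterate_const_mul] at this
    rw [mul_add, mul_one, add_comm, Function.iterate_add_apply]
    refine le_trans ?_ this
    exact le_mul_of_one_le_right (by positivity) (hg1 p)
  -- After `T (k + 1)` levels there are at most `A ^ (k + 1)` boundary points against at least `2 ^
  -- (T k)` interior ones.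
  have hlim : Tendsto (fun k : ℕ => (A / 2 ^ T) ^ k * A) atTop (𝓝 0) := by
    have := tendsto_pow_atTop_nhds_zero_of_lt_one (r := A / 2 ^ T) (by positivity)
      (by rw [div_lt_one (by positivity)]; linarith)
    simpa using this.mul_const A
  obtain ⟨k, hk⟩ := (hlim.eventually (ge_mem_nhds hε)).exists
  refine ⟨T * (k + 1), fun p => (hupper _ p).trans ?_⟩
  refine le_trans ?_ (mul_le_mul_of_nonneg_left (hlower k p) hε.le)
  rw [div_pow, ← pow_mul, div_mul_eq_mul_div, div_le_iff₀ (by positivity)] at hk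
  rwa [pow_succ]

/-- The tower is split into `s` outer and `t` inner levels. Where the outer levels reach the
interior, the inner sum is `2ᵗ` times a small average. Elsewhere it is at most `2ᵗ M`, and `s` makes
these places rare. -/
theorem exists_abs_tower_le {n : ℕ} (hn : 1 ≤ n) {f : Gamma n → ℝ} (hf : Continuous f)
    (hint : ∫ p, f p ∂lam n = 0) {ε : ℝ} (hε : 0 < ε) :
    ∃ t, ∀ p, |(tower n)^[t] f p| ≤ ε * (tower n)^[t] (fun _ => 1) p := by
  obtain ⟨M, hM⟩ := (isCompact_range hf).isBounded.exists_norm_le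
  have hM' : ∀ p, |f p| ≤ M := fun p => hM _ ⟨p, rfl⟩
  have hM0 : 0 ≤ M := (abs_nonneg _).trans (hM' (vZero n))
  obtain ⟨t, ht⟩ := avg_uniform_limit hn hf (half_pos hε)
  -- The denominator is `M + 1` because `M` may be `0`.
  obtain ⟨s, hs⟩ := exists_tower_compl_le hn (ε := ε / 2 / (M + 1)) (by positivity)
  simp only [hint, sub_zero] at ht
  set I := openGamma n
  set g : Gamma n → ℝ := I.indicator 1 with hg
  set h : Gamma n → ℝ := Iᶜ.indicator 1 with hh
  have hg0 : ∀ p, 0 ≤ g p := fun p => Set.indicator_nonneg (fun _ _ => zero_le_one) p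
  have hh0 : ∀ p, 0 ≤ h p := fun p => Set.indicator_nonneg (fun _ _ => zero_le_one) p
  have hcomp : ∀ p, |(tower n)^[t] f p| ≤ 2 ^ t * (ε / 2) * g p + 2 ^ t * M * h p := by
    intro p
    by_cases hp : p ∈ I
    · rw [hg, hh, Set.indicator_of_mem hp, Set.indicator_of_notMem (Set.notMem_compl_iff.mpr hp),
        tower_iterate_of_mem hn t f hp, abs_mul, abs_of_pos (by positivity : (0 : ℝ) < 2 ^ t)]
      have := mul_le_mul_of_nonneg_left (ht p) (by positivity : (0 : ℝ) ≤ 2 ^ t)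
      simpa using this
    · rw [hg, hh, Set.indicator_of_notMem hp, Set.indicator_of_mem (show p ∈ Iᶜ from hp)]
      have h1 := abs_tower_iterate_le t (g := fun _ => M * 1) (fun p => by simpa using hM' p) p
      rw [tower_iterate_const_mul] at h1
      have h2 := mul_le_mul_of_nonneg_left (tower_iterate_one_le t p) hM0
      simp only [Pi.one_apply]
      linarith
  have hone : (fun p => 2 ^ t * g p) ≤ (tower n)^[t] fun _ => (1 : ℝ) := by
    intro p
    change 2 ^ t * g p ≤ _
    by_cases hp : p ∈ I
    · have hone : ∀ k q, (avg n)^[k] (fun _ => (1 : ℝ)) q = 1 := by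
        intro k
        induction k with
        | zero => intro q; rfl
        | succ k ih => intro q; rw [Function.iterate_succ_apply']; simp [avg, ih]
      rw [tower_iterate_of_mem hn t _ hp, hg, Set.indicator_of_mem hp, hone]
      rfl
    · rw [hg, Set.indicator_of_notMem hp, mul_zero]
      exact tower_iterate_nonneg t (fun _ => zero_le_one) p
  refine ⟨s + t, fun p => ?_⟩
  rw [Function.iterate_add_apply, Function.iterate_add_apply]
  have h1 := abs_tower_iterate_le s hcomp p
  have h2 := tower_monotone.iterate s hone p
  rw [tower_iterate_linear] at h1
  rw [tower_iterate_const_mul] at h2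
  have h3 := hs p
  have hG := tower_iterate_nonneg s hg0 p
  set G := (tower n)^[s] g p
  set H := (tower n)^[s] h p
  have h4 : M * H ≤ ε / 2 * G := by
    have h5 : M * H ≤ (M + 1) * H :=
      mul_le_mul_of_nonneg_right (by linarith) (tower_iterate_nonneg s hh0 p)
    have h6 := mul_le_mul_of_nonneg_left h3 (by linarith : 0 ≤ M + 1)
    have h7 : (M + 1) * (ε / 2 / (M + 1) * G) = ε / 2 * G := by
      field_simp
    linarith
  have h8 := mul_le_mul_of_nonneg_left h4 (by positivity : (0 : ℝ) ≤ 2 ^ t)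
  have h9 := mul_le_mul_of_nonneg_left h2 hε.le
  linarith

/-! ### Uniform distribution and unique ergodicity -/

/-- After an initial stretch leading into `τ₀ᵗ Γ`, the orbit consists of blocks of length at most
`2ᵗ`, each with a sum at most `ε` times its length. The constant `C` absorbs the initial stretch and
the last incomplete block. -/
theorem exists_abs_birkhoffSum_le {n : ℕ} (hn : 1 ≤ n) {f : Gamma n → ℝ} (hf : Continuous f)
    (hint : ∫ p, f p ∂lam n = 0) {ε : ℝ} (hε : 0 < ε) (p : Gamma n) :
    ∃ C, ∀ m : ℕ, |birkhoffSum (K n) f m p| ≤ ε * m + C := by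
  obtain ⟨M, hM⟩ := (isCompact_range hf).isBounded.exists_norm_le
  have hM' : ∀ p, |f p| ≤ M := fun p => hM _ ⟨p, rfl⟩
  have hM0 : 0 ≤ M := (abs_nonneg _).trans (hM' (vZero n))
  have htriv : ∀ m q, |birkhoffSum (K n) f m q| ≤ m * M := fun m q => by
    refine (Finset.abs_sum_le_sum_abs _ _).trans ((Finset.sum_le_sum fun i _ => hM' _).trans ?_)
    simp
  obtain ⟨t, ht⟩ := exists_abs_tower_le hn hf hint hε
  obtain ⟨i, q, hq⟩ := exists_iterate_eq_tau_zero hn t p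
  set R : Gamma n → ℕ := (tower n)^[t] fun _ => 1 with hR
  have hRr : ∀ x, (R x : ℝ) = (tower n)^[t] (fun _ => (1 : ℝ)) x := tower_iterate_natCast t
  have hR2 : ∀ x, R x ≤ 2 ^ t := fun x => by
    have := tower_iterate_one_le t x
    rw [← hRr] at this
    exact_mod_cast this
  have hR1 : ∀ x, 1 ≤ R x := fun x => by
    have := le_tower_iterate t (f := fun _ : Gamma n => (1 : ℝ)) (fun _ => zero_le_one) x
    rw [← hRr] at this
    exact_mod_cast this
  have hblock : ∀ N, |birkhoffSum (K n) f (birkhoffSum (K n) R N q) ((tau n 0)^[t] q)| ≤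
      ε * (birkhoffSum (K n) R N q : ℕ) := fun N => by
    rw [hR, birkhoffSum_tau_zero_iterate hn, ← hR]
    refine (Finset.abs_sum_le_sum_abs _ _).trans ((Finset.sum_le_sum fun i _ => ht _).trans ?_)
    rw [← Finset.mul_sum, birkhoffSum, Nat.cast_sum]
    simp only [hRr, le_refl]
  have hfit : ∀ m, ∃ N l, m = birkhoffSum (K n) R N q + l ∧ l < 2 ^ t := by
    intro m
    induction m with
    | zero => exact ⟨0, 0, by simp, by positivity⟩
    | succ m ih =>
      obtain ⟨N, l, hm, hl⟩ := ih
      by_cases h : l + 1 < 2 ^ t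
      · exact ⟨N, l + 1, by omega, h⟩
      · have h1 := hR1 ((K n)^[N] q)
        have h2 := hR2 ((K n)^[N] q)
        -- Here `l + 1 = 2ᵗ`, so the remainder is long enough to complete another block, and `R ≥ 1`
        -- makes the new remainder smaller than `2ᵗ`.
        refine ⟨N + 1, 2 ^ t - R ((K n)^[N] q), ?_, by omega⟩
        rw [birkhoffSum_succ]
        omega
  have hlate : ∀ m : ℕ, |birkhoffSum (K n) f m ((tau n 0)^[t] q)| ≤ ε * m + 2 ^ t * M := by
    intro m
    obtain ⟨N, l, rfl, hl⟩ := hfit m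
    rw [birkhoffSum_add]
    refine (abs_add_le _ _).trans ?_
    have h1 := hblock N
    have h2 := htriv l ((K n)^[birkhoffSum (K n) R N q] ((tau n 0)^[t] q))
    have h3 : (l : ℝ) ≤ 2 ^ t := by exact_mod_cast hl.le
    have h4 := mul_le_mul_of_nonneg_right h3 hM0
    have h5 : 0 ≤ ε * l := by positivity
    push_cast
    linarith
  refine ⟨i * M + 2 ^ t * M, fun m => ?_⟩
  have hi : (0 : ℝ) ≤ i * M := by positivity
  have hpow : (0 : ℝ) ≤ 2 ^ t * M := by positivity
  rcases le_total m i with h | h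
  · have h1 := htriv m p
    have h2 : (m : ℝ) ≤ i := by exact_mod_cast h
    have h3 := mul_le_mul_of_nonneg_right h2 hM0
    have h4 : 0 ≤ ε * m := by positivity
    linarith
  · obtain ⟨l, rfl⟩ := Nat.exists_eq_add_of_le h
    rw [birkhoffSum_add, hq]
    refine (abs_add_le _ _).trans ?_
    have h1 := htriv i p
    have h2 := hlate l
    have h3 : 0 ≤ ε * i := by positivity
    push_cast
    linarith

theorem K_uniformlyDistributed {n : ℕ} (hn : 1 ≤ n) (p : Gamma n) :
    UniformlyDistributed (lam n) fun i => (K n)^[i] p := by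
  intro f
  set J := ∫ y, f y ∂lam n with hJ
  have hcont : Continuous fun x => f x - J := f.continuous.sub continuous_const
  have hint : ∫ x, (f x - J) ∂lam n = 0 := by
    rw [integral_sub (integrable_of_continuous f.continuous) (integrable_const _)]
    simp [hJ]
  rw [Metric.tendsto_atTop]
  intro ε hε
  obtain ⟨C, hC⟩ := exists_abs_birkhoffSum_le hn hcont hint (half_pos hε) p
  obtain ⟨N, hN⟩ := exists_nat_gt (2 * C / ε)
  refine ⟨N + 1, fun k hk => ?_⟩
  have hk0 : (0 : ℝ) < k := by
    have : 0 < k := by omega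
    exact_mod_cast this
  have hNk : (N : ℝ) ≤ k := by
    have : N ≤ k := by omega
    exact_mod_cast this
  have h1 := hC k
  have h2 : birkhoffSum (K n) (fun x => f x - J) k p =
      ∑ i ∈ Finset.range k, f ((K n)^[i] p) - k * J := by
    simp [birkhoffSum, Finset.sum_sub_distrib]
  have h3 : 1 / (k : ℝ) * ∑ i ∈ Finset.range k, f ((K n)^[i] p) - J =
      birkhoffSum (K n) (fun x => f x - J) k p / k := by
    rw [h2]
    field_simp
  rw [Real.dist_eq, h3, abs_div, abs_of_pos hk0, div_lt_iff₀ hk0]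
  have h4 := hN.trans_le hNk
  rw [div_lt_iff₀ hε] at h4
  linarith

/-- The Birkhoff averages of `f` all have `m`-integral `∫ f dm` by invariance. They converge at
every point to `∫ f dλ`, so dominated convergence equates the two integrals. -/
theorem eq_lam_of_measurePreserving {n : ℕ} (hn : 1 ≤ n) (m : Measure (Gamma n))
    [IsProbabilityMeasure m] (hm : MeasurePreserving (K n) m m) : m = lam n := by
  refine ext_of_forall_integral_eq_of_IsFiniteMeasure fun f => ?_
  have hf : Continuous f := f.continuous
  have hmeas : ∀ i, Measurable fun p => f ((K n)^[i] p) := fun i =>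
    hf.measurable.comp ((K_measurable hn).iterate i)
  have hint : ∀ i, Integrable (fun p => f ((K n)^[i] p)) m := fun i =>
    Integrable.of_bound (hmeas i).aestronglyMeasurable ‖f‖
      (Eventually.of_forall fun p => f.norm_coe_le_norm _)
  have hi : ∀ i, ∫ p, f ((K n)^[i] p) ∂m = ∫ p, f p ∂m := fun i => by
    have h := hm.iterate i
    conv_rhs => rw [← h.map_eq]
    rw [integral_map h.measurable.aemeasurable hf.aestronglyMeasurable]
  have hlim : Tendsto (fun k : ℕ => ∫ p, 1 / (k : ℝ) * ∑ i ∈ Finset.range k, f ((K n)^[i] p) ∂m)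
      atTop (𝓝 (∫ _, ∫ y, f y ∂lam n ∂m)) := by
    refine tendsto_integral_of_dominated_convergence (fun _ => ‖f‖) (fun k => ?_)
      (integrable_const _) (fun k => Eventually.of_forall fun p => ?_)
      (Eventually.of_forall fun p => K_uniformlyDistributed hn p f.toContinuousMap)
    · exact ((Finset.measurable_fun_sum _ fun i _ => hmeas i).const_mul _).aestronglyMeasurable
    · rw [norm_mul, Real.norm_of_nonneg (by positivity)]
      have : ‖∑ i ∈ Finset.range k, f ((K n)^[i] p)‖ ≤ k * ‖f‖ := by
        refine (norm_sum_le _ _).trans ((Finset.sum_le_sum fun i _ => f.norm_coe_le_norm _).trans ?_)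
        simp
      rcases Nat.eq_zero_or_pos k with rfl | hk
      · simp
      · have hk' : (0 : ℝ) < k := by exact_mod_cast hk
        rw [one_div, inv_mul_le_iff₀ hk']
        exact this
  rw [integral_const, probReal_univ, one_smul] at hlim
  refine tendsto_nhds_unique (Tendsto.congr' ?_ tendsto_const_nhds) hlim
  filter_upwards [eventually_gt_atTop 0] with k hk
  have hk' : (k : ℝ) ≠ 0 := by exact_mod_cast hk.ne'
  rw [integral_const_mul, integral_finsetSum _ fun i _ => hint i]
  simp only [hi, Finset.sum_const, Finset.card_range, nsmul_eq_mul]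
  field_simp

end KakutaniSimplex

theorem mainTheorem1 (n : ℕ) (hn : 1 ≤ n) :
    Function.Bijective (KakutaniSimplex.K n) ∧
    (∀ p : KakutaniSimplex.Gamma n,
      KakutaniSimplex.UniformlyDistributed (KakutaniSimplex.lam n)
        (fun i => (KakutaniSimplex.K n)^[i] p)) ∧
    KakutaniSimplex.UniquelyErgodicWith (KakutaniSimplex.K n) (KakutaniSimplex.lam n) := by
  refine ⟨⟨KakutaniSimplex.K_injective hn, KakutaniSimplex.K_surjective hn⟩,
    KakutaniSimplex.K_uniformlyDistributed hn, fun m => ⟨fun ⟨h1, h2⟩ => ?_, ?_⟩⟩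
  · exact KakutaniSimplex.eq_lam_of_measurePreserving hn m h2
  · rintro rfl
    exact ⟨inferInstance, KakutaniSimplex.K_measurePreserving hn⟩
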